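/- All graphs are finite and simple. Write $P_n$, $C_n$, $K_n$ for the path, cycle and complete graph on $n$ vertices, $G+H$ for disjoint union, $nG$ for the disjoint union of $n$ copies of $G$, and $\overline{G}$ for the complement; the banner $P$ is the graph obtained from $C_4$ by attaching one pendant vertex to one of its vertices. A graph $G=(V,E)$ is \emph{$P_4$-extendible} if for every $W\subseteq V$ inducing a $P_4$ there is at most one vertex $v\notin W$ that belongs to an induced $P_4$ of $G$ sharing at least one vertex with $W$. A graph $G$ is \emph{$(\infty,1)$-polar} if $V$ has a partition $(A,B)$, where either set may be empty, such that $G[A]$ is a complete multipartite graph with any number of parts and $B$ is a clique. A \emph{minimal $(\infty,1)$-polar obstruction} is a graph that is not $(\infty,1)$-polar but all of whose proper induced subgraphs are. Theorem. Let $G$ be a $P_4$-extendible graph. Then $G$ is a minimal $(\infty,1)$-polar obstruction if and only if $G$ is isomorphic to one of the seven graphs $$K_1+2K_2,\quad 2P_3,\quad C_4+2K_1,\quad K_1+\overline{P_3+K_2},\quad K_1+C_5,\quad K_1+P,\quad K_1+\overline{P_5}.$$ -/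

import Mathlib

namespace PolarGraph

/-- `H` is a complete multipartite graph with at most `s` (nonempty) parts; the parts are the
classes of the non-adjacency relation. For `s = ⊤` the number of parts is unbounded. -/
def IsCompleteMultipartiteWith {V : Type*} (s : ℕ∞) (H : SimpleGraph V) : Prop :=
  ∃ h : H.IsCompleteMultipartite, ENat.card (Quotient h.setoid) ≤ s

/-- `H` is a `k`-cluster: its complement is complete multipartite with at most `k` parts, that is,
`H` is a disjoint union of at most `k` complete graphs. -/
def IsCluster {V : Type*} (k : ℕ∞) (H : SimpleGraph V) : Prop :=
  IsCompleteMultipartiteWith k Hᶜ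

/-- `G` is `(s, k)`-polar: its vertex set has a partition `(A, B)` (either side may be empty) such
that `G[A]` is complete multipartite with at most `s` parts and `G[B]` is a `k`-cluster. -/
def IsPolar {V : Type*} (s k : ℕ∞) (G : SimpleGraph V) : Prop :=
  ∃ A B : Set V, Disjoint A B ∧ A ∪ B = Set.univ ∧
    IsCompleteMultipartiteWith s (G.induce A) ∧ IsCluster k (G.induce B)

/-- `G` is a minimal `(s, k)`-polar obstruction: `G` is not `(s, k)`-polar, but all its proper
induced subgraphs are. -/
def IsMinimalPolarObstruction {V : Type*} (s k : ℕ∞) (G : SimpleGraph V) : Prop :=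
  ¬ IsPolar s k G ∧ ∀ S : Set V, S ≠ Set.univ → IsPolar s k (G.induce S)

/-- The vertex set `W` induces a `P₄`, the path on four vertices. -/
def InducesP4 {V : Type*} (G : SimpleGraph V) (W : Set V) : Prop :=
  Nonempty (G.induce W ≃g SimpleGraph.pathGraph 4)

/-- `G` is `P₄`-extendible: for every vertex set `W` inducing a `P₄`, at most one vertex outside
`W` belongs to an induced `P₄` that shares a vertex with `W`. -/
def IsP4Extendible {V : Type*} (G : SimpleGraph V) : Prop :=
  ∀ W : Set V, InducesP4 G W →
    {v : V | v ∉ W ∧ ∃ W' : Set V, InducesP4 G W' ∧ v ∈ W' ∧ (W' ∩ W).Nonempty}.Subsingleton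

/-- The complete graph `Kₙ`. -/
abbrev K (n : ℕ) : SimpleGraph (Fin n) := SimpleGraph.completeGraph (Fin n)

/-- The banner `P`: a cycle on the four vertices `0, 1, 2, 3` and a vertex `4` whose only
neighbour is `2`. -/
def banner : SimpleGraph (Fin 5) :=
  SimpleGraph.fromEdgeSet {s(0, 1), s(1, 2), s(2, 3), s(3, 0), s(2, 4)}

open SimpleGraph in
/-- `G` is isomorphic to one of the seven graphs `K₁ + 2K₂`, `2P₃`, `C₄ + 2K₁`,
`K₁ + (P₃ + K₂)ᶜ`, `K₁ + C₅`, `K₁ + P`, `K₁ + (P₅)ᶜ`. -/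
def IsEssential {V : Type*} (G : SimpleGraph V) : Prop :=
  Nonempty (G ≃g K 1 ⊕g (K 2 ⊕g K 2)) ∨
  Nonempty (G ≃g pathGraph 3 ⊕g pathGraph 3) ∨
  Nonempty (G ≃g cycleGraph 4 ⊕g (K 1 ⊕g K 1)) ∨
  Nonempty (G ≃g K 1 ⊕g (pathGraph 3 ⊕g K 2)ᶜ) ∨
  Nonempty (G ≃g K 1 ⊕g cycleGraph 5) ∨
  Nonempty (G ≃g K 1 ⊕g banner) ∨
  Nonempty (G ≃g K 1 ⊕g (pathGraph 5)ᶜ)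

end PolarGraph

/-! That each of the seven graphs is a minimal obstruction is a finite check: an exhaustive search
over cliques, plus an explicit clique for every vertex deletion. For the converse, let `G` be a
minimal obstruction other than these seven. By minimality it contains none of them as an induced
subgraph (`EssentialFree`). A join of two polar graphs is polar, since both cliques and complete
multipartite graphs are closed under joins; so the complement of `G` is connected. `G` itself is
connected too. If it has an isolated vertex `v`, then either it contains a `C₄`, which forces `G -
v` to be complete multipartite, or it has no `2K₂`, `C₄`, `C₅` and is split by Földes–Hammer. If it
is disconnected without isolated vertices, excluding `K₁ + 2K₂` makes both sides complete
multipartite, and excluding `2P₃` makes one of them a clique. By Seinsche's theorem `G` therefore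
contains an induced `P₄` `a b c d`. Extendibility leaves at most one exceptional vertex `e`. Every
other vertex sees all, none, or exactly the inner two of `a`, `b`, `c`, `d`. The first two kinds
vanish: the remaining vertices form a homogeneous set containing a `P₄`, and a minimal obstruction
has no such proper subset (`Obstruction.eq_empty_of_homogeneous`). The vertices of the third kind
induce a split graph, and for each possible attachment of `e` a polar partition of all of `G` can be
written down, a contradiction. -/

namespace PolarGraph

open SimpleGraph

variable {V W : Type*}

/-! ### Polarity and minimal obstructions in terms of vertex sets -/

/-- The subgraph of `G` induced by `S` is `(∞, 1)`-polar, the set `B` cutting out the clique. -/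
def PolarOn (G : SimpleGraph V) (S : Set V) : Prop :=
  ∃ B : Set V, (∀ x ∈ S, ∀ y ∈ S, x ∈ B → y ∈ B → x ≠ y → G.Adj x y) ∧
    ∀ x ∈ S, ∀ y ∈ S, ∀ z ∈ S, x ∉ B → y ∉ B → z ∉ B →
      ¬ G.Adj x y → ¬ G.Adj y z → ¬ G.Adj x z

theorem PolarOn.mono {G : SimpleGraph V} {S T : Set V} (h : PolarOn G T) (hST : S ⊆ T) :
    PolarOn G S := by
  obtain ⟨B, h1, h2⟩ := h
  exact ⟨B, fun x hx y hy => h1 x (hST hx) y (hST hy),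
    fun x hx y hy z hz => h2 x (hST hx) y (hST hy) z (hST hz)⟩

theorem PolarOn.comap {G : SimpleGraph V} {H : SimpleGraph W} {S : Set V} {T : Set W}
    (f : W → V) (hf : Function.Injective f) (hadj : ∀ i j, G.Adj (f i) (f j) ↔ H.Adj i j)
    (hT : ∀ i ∈ T, f i ∈ S) (h : PolarOn G S) : PolarOn H T := by
  obtain ⟨B, h1, h2⟩ := h
  refine ⟨f ⁻¹' B, ?_, ?_⟩
  · intro x hx y hy hxB hyB hne
    exact (hadj x y).1 (h1 _ (hT x hx) _ (hT y hy) hxB hyB (fun e => hne (hf e)))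
  · intro x hx y hy z hz hxB hyB hzB
    simp only [← hadj]
    exact h2 _ (hT x hx) _ (hT y hy) _ (hT z hz) hxB hyB hzB

theorem isCompleteMultipartiteWith_top {H : SimpleGraph V} :
    IsCompleteMultipartiteWith ⊤ H ↔ H.IsCompleteMultipartite :=
  ⟨fun h => h.1, fun h => ⟨h, le_top⟩⟩

theorem isCluster_one {H : SimpleGraph V} :
    IsCluster 1 H ↔ ∀ x y, x ≠ y → H.Adj x y := by
  constructor
  · rintro ⟨h, hc⟩ x y hxy
    have := (ENat.card_le_one_iff_subsingleton _).1 hc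
    have h2 : (Quotient.mk h.setoid x) = Quotient.mk h.setoid y := Subsingleton.elim _ _
    have h3 : ¬ Hᶜ.Adj x y := Quotient.exact h2
    rw [compl_adj] at h3
    by_contra h4
    exact h3 ⟨hxy, h4⟩
  · intro h
    have h0 : ∀ x y, ¬ Hᶜ.Adj x y := by
      intro x y hxy
      rw [compl_adj] at hxy
      exact hxy.2 (h _ _ hxy.1)
    have hm : Hᶜ.IsCompleteMultipartite := ⟨fun x y z _ _ => h0 x z⟩
    refine ⟨hm, (ENat.card_le_one_iff_subsingleton _).2 ⟨?_⟩⟩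
    rintro ⟨x⟩ ⟨y⟩
    exact Quotient.sound (h0 x y)

theorem isPolar_iff (G : SimpleGraph V) : IsPolar ⊤ 1 G ↔ PolarOn G Set.univ := by
  unfold IsPolar
  simp only [isCompleteMultipartiteWith_top, isCluster_one]
  constructor
  · rintro ⟨A, B, hd, hu, hA, hB⟩
    refine ⟨B, ?_, ?_⟩
    · intro x _ y _ hx hy hne
      exact hB ⟨x, hx⟩ ⟨y, hy⟩ (by simpa using hne)
    · intro x _ y _ z _ hx hy hz
      have mem : ∀ w, w ∉ B → w ∈ A := fun w hw => by
        have : w ∈ A ∪ B := hu ▸ Set.mem_univ w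
        exact this.resolve_right hw
      exact hA.trans ⟨x, mem x hx⟩ ⟨y, mem y hy⟩ ⟨z, mem z hz⟩
  · rintro ⟨B, h1, h2⟩
    refine ⟨Bᶜ, B, disjoint_compl_left, Set.compl_union_self B, ⟨?_⟩, ?_⟩
    · rintro ⟨x, hx⟩ ⟨y, hy⟩ ⟨z, hz⟩
      exact h2 x trivial y trivial z trivial hx hy hz
    · rintro ⟨x, hx⟩ ⟨y, hy⟩ hne
      exact h1 x trivial y trivial hx hy (by simpa using hne)

theorem isPolar_induce_iff (G : SimpleGraph V) (S : Set V) :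
    IsPolar ⊤ 1 (G.induce S) ↔ PolarOn G S := by
  rw [isPolar_iff]
  constructor
  · rintro ⟨B, h1, h2⟩
    refine ⟨(↑) '' B, ?_, ?_⟩
    · rintro x hx y hy hxB hyB hne
      refine h1 ⟨x, hx⟩ trivial ⟨y, hy⟩ trivial ?_ ?_ (by simpa using hne)
      · simpa [hx] using hxB
      · simpa [hy] using hyB
    · rintro x hx y hy z hz hxB hyB hzB
      refine h2 ⟨x, hx⟩ trivial ⟨y, hy⟩ trivial ⟨z, hz⟩ trivial ?_ ?_ ?_
      · simpa [hx] using hxB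
      · simpa [hy] using hyB
      · simpa [hz] using hzB
  · exact PolarOn.comap (fun x => x.1) Subtype.val_injective (fun _ _ => Iff.rfl) (fun i _ => i.2)

/-- `G` is a minimal `(∞, 1)`-polar obstruction, in terms of vertex sets. -/
def Obstruction (G : SimpleGraph V) : Prop :=
  ¬ PolarOn G Set.univ ∧ ∀ S : Set V, S ≠ Set.univ → PolarOn G S

theorem isMinimalPolarObstruction_iff (G : SimpleGraph V) :
    IsMinimalPolarObstruction ⊤ 1 G ↔ Obstruction G := by
  simp only [IsMinimalPolarObstruction, Obstruction, isPolar_iff G, isPolar_induce_iff]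

theorem Obstruction.of_iso {G : SimpleGraph V} {H : SimpleGraph W} (e : G ≃g H)
    (h : Obstruction H) : Obstruction G := by
  refine ⟨fun hG => h.1 (PolarOn.comap (S := Set.univ) e.symm e.symm.injective
    (fun _ _ => e.symm.map_adj_iff) (fun _ _ => trivial) hG), fun S hS => ?_⟩
  refine PolarOn.comap (S := e '' S) e e.injective (fun _ _ => e.map_adj_iff)
    (fun i hi => ⟨i, hi, rfl⟩) (h.2 (e '' S) ?_)
  intro hu
  apply hS
  ext x
  have : e x ∈ e '' S := hu ▸ Set.mem_univ _
  simpa using this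

/-- A minimal obstruction containing a non-polar graph `H` is isomorphic to `H`. -/
theorem Obstruction.iso_of_embedding {G : SimpleGraph V} {H : SimpleGraph W} (hG : Obstruction G)
    (hH : Obstruction H) (f : W → V) (hf : Function.Injective f)
    (hadj : ∀ i j, G.Adj (f i) (f j) ↔ H.Adj i j) : Nonempty (G ≃g H) := by
  have hs : Function.Surjective f := by
    by_contra hs
    apply hH.1
    exact PolarOn.comap (S := Set.range f) f hf hadj (fun i _ => ⟨i, rfl⟩)
      (hG.2 _ (fun hu => hs (Set.range_eq_univ.1 hu)))
  exact ⟨RelIso.symm ⟨Equiv.ofBijective f ⟨hf, hs⟩, fun {a b} => hadj a b⟩⟩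

/-- It suffices to check the removal of single vertices. -/
theorem obstruction_of_vertices {G : SimpleGraph V} (h : ¬ PolarOn G Set.univ)
    (B : V → V → Prop)
    (h1 : ∀ v x y, x ≠ v → y ≠ v → B v x → B v y → x ≠ y → G.Adj x y)
    (h2 : ∀ v x y z, x ≠ v → y ≠ v → z ≠ v → ¬ B v x → ¬ B v y → ¬ B v z →
      ¬ G.Adj x y → ¬ G.Adj y z → ¬ G.Adj x z) : Obstruction G := by
  refine ⟨h, fun S hS => ?_⟩
  obtain ⟨v, hv⟩ := (Set.ne_univ_iff_exists_notMem S).1 hS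
  refine PolarOn.mono (T := {v}ᶜ) ⟨{x | B v x}, ?_, ?_⟩ (fun x hx e => hv (e ▸ hx))
  · intro x hx y hy
    exact h1 v x y hx hy
  · intro x hx y hy z hz
    exact h2 v x y z hx hy hz

/-! ### The seven graphs are minimal obstructions -/

instance {G : SimpleGraph V} {H : SimpleGraph W} [DecidableRel G.Adj] [DecidableRel H.Adj] :
    DecidableRel (G ⊕g H).Adj
  | .inl x, .inl y => decidable_of_iff (G.Adj x y) sum_adj_inl.symm
  | .inr x, .inr y => decidable_of_iff (H.Adj x y) sum_adj_inr.symm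
  | .inl _, .inr _ => .isFalse (by simp)
  | .inr _, .inl _ => .isFalse (by simp)

instance (n : ℕ) : DecidableRel (pathGraph n).Adj := fun _ _ =>
  decidable_of_iff _ pathGraph_adj.symm

instance : DecidableRel banner.Adj := 
  inferInstanceAs (DecidableRel (SimpleGraph.fromEdgeSet _).Adj)

theorem not_polarOn_of_bool {W : Type*} (H : SimpleGraph W)
    (h : ∀ b : W → Bool, (∃ x y, x ≠ y ∧ ¬ H.Adj x y ∧ b x = true ∧ b y = true) ∨
      ∃ x y, H.Adj x y ∧ b x = false ∧ b y = false ∧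
        ∃ z, ¬ H.Adj x z ∧ ¬ H.Adj z y ∧ b z = false) :
    ¬ PolarOn H Set.univ := by
  classical
  rintro ⟨B, h1, h2⟩
  rcases h (fun x => decide (x ∈ B)) with ⟨x, y, hne, hn, hx, hy⟩ | ⟨x, y, ha, hx, hy, z, h3, h4, hz⟩
  · exact hn (h1 x trivial y trivial (by simpa using hx) (by simpa using hy) hne)
  · exact h2 x trivial z trivial y trivial (by simpa using hx) (by simpa using hz)
      (by simpa using hy) h3 h4 ha

/-- Everything is phrased through Boolean functions so that the kernel can evaluate it. The
quantifiers are nested so that the cheap tests come before the innermost vertex is enumerated. -/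
theorem obstruction_of_bool {W : Type*} [Fintype W] [DecidableEq W] (H : SimpleGraph W)
    [DecidableRel H.Adj] (b : W → W → Bool)
    (h : decide (∀ b : W → Bool, (∃ x y, x ≠ y ∧ ¬ H.Adj x y ∧ b x = true ∧ b y = true) ∨
      ∃ x y, H.Adj x y ∧ b x = false ∧ b y = false ∧
        ∃ z, ¬ H.Adj x z ∧ ¬ H.Adj z y ∧ b z = false) = true)
    (h1 : decide (∀ v x y,
      x = v ∨ y = v ∨ b v x = false ∨ b v y = false ∨ x = y ∨ H.Adj x y) = true)
    (h2 : decide (∀ v x z, H.Adj x z → x = v ∨ z = v ∨ b v x = true ∨ b v z = true ∨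
      ∀ y, y = v ∨ b v y = true ∨ H.Adj x y ∨ H.Adj y z) = true) : Obstruction H := by
  refine obstruction_of_vertices (not_polarOn_of_bool H (of_decide_eq_true h))
    (fun v x => b v x = true) ?_ ?_
  · intro v x y hx hy hxb hyb hne
    have := of_decide_eq_true h1 v x y
    simp_all
  · intro v x y z hx hy hz hxb hyb hzb h3 h4 h5
    rcases of_decide_eq_true h2 v x z h5 with h | h | h | h | h
    · exact hx h
    · exact hz h
    · exact hxb h
    · exact hzb h
    · rcases h y with h | h | h | h
      · exact hy h
      · exact hyb h
      · exact h3 h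
      · exact h4 h

set_option maxRecDepth 100000

theorem obstruction_K1_2K2 : Obstruction (K 1 ⊕g (K 2 ⊕g K 2)) := by
  -- Here and in the next six proofs the function marks, for each deleted vertex `v`, the clique of
  -- a polar partition of the rest.
  refine obstruction_of_bool _ (fun v x => match v, x with
    | .inr (.inl _), .inr (.inr _) => true
    | .inr (.inl _), _ => false
    | _, .inr (.inl _) => true
    | _, _ => false) ?_ ?_ ?_ <;> decide +kernel

theorem obstruction_2P3 : Obstruction (pathGraph 3 ⊕g pathGraph 3) := by
  refine obstruction_of_bool _ (fun v x => match v, x with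
    | .inl 1, .inr 0 => true
    | .inl 1, .inr 1 => true
    | .inl 1, _ => false
    | .inl _, .inl _ => true
    | .inr 1, .inl 0 => true
    | .inr 1, .inl 1 => true
    | .inr 1, _ => false
    | .inr _, .inr _ => true
    | _, _ => false) ?_ ?_ ?_ <;> decide +kernel

theorem obstruction_C4_2K1 : Obstruction (cycleGraph 4 ⊕g (K 1 ⊕g K 1)) := by
  refine obstruction_of_bool _ (fun v x => match v, x with
    | .inl i, .inl j => decide (j = i + 1 ∨ j = i + 2)
    | .inr _, .inr _ => true
    | _, _ => false) ?_ ?_ ?_ <;> decide +kernel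

theorem obstruction_K1_compl_P3_K2 : Obstruction (K 1 ⊕g (pathGraph 3 ⊕g K 2)ᶜ) := by
  refine obstruction_of_bool _ (fun v x => match v, x with
    | .inl _, .inr (.inl 0) => true
    | .inr (.inl _), .inl _ => true
    | .inr (.inr _), .inr (.inl 0) => true
    | .inr (.inr _), .inr (.inl 2) => true
    | .inr (.inr _), .inr (.inr _) => true
    | _, _ => false) ?_ ?_ ?_ <;> decide +kernel

theorem obstruction_K1_C5 : Obstruction (K 1 ⊕g cycleGraph 5) := by
  refine obstruction_of_bool _ (fun v x => match v, x with
    | .inl _, .inr j => decide (j = 0 ∨ j = 1)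
    | .inr i, .inr j => decide (j = i + 2 ∨ j = i + 3)
    | _, _ => false) ?_ ?_ ?_ <;> decide +kernel

theorem obstruction_K1_banner : Obstruction (K 1 ⊕g banner) := by
  refine obstruction_of_bool _ (fun v x => match v, x with
    | .inl _, .inr j => decide (j = 4 ∨ j = 2)
    | .inr 4, .inl _ => true
    | .inr 0, .inr j => decide (j = 2)
    | .inr 1, .inr j => decide (j = 2 ∨ j = 3)
    | .inr 3, .inr j => decide (j = 1 ∨ j = 2)
    | .inr 2, .inr j => decide (j = 0)
    | _, _ => false) ?_ ?_ ?_ <;> decide +kernel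

theorem obstruction_K1_compl_P5 : Obstruction (K 1 ⊕g (pathGraph 5)ᶜ) := by
  refine obstruction_of_bool _ (fun v x => match v, x with
    | .inl _, .inr j => decide (j = 2)
    | .inr 2, .inl _ => true
    | .inr 0, .inr j => decide (j = 1 ∨ j = 4)
    | .inr 4, .inr j => decide (j = 0 ∨ j = 3)
    | .inr 1, .inr j => decide (j = 0 ∨ j = 2 ∨ j = 4)
    | .inr 3, .inr j => decide (j = 0 ∨ j = 2 ∨ j = 4)
    | _, _ => false) ?_ ?_ ?_ <;> decide +kernel

theorem IsEssential.obstruction {V : Type*} {G : SimpleGraph V} (h : IsEssential G) :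
    Obstruction G := by
  rcases h with ⟨⟨e⟩⟩ | ⟨⟨e⟩⟩ | ⟨⟨e⟩⟩ | ⟨⟨e⟩⟩ | ⟨⟨e⟩⟩ | ⟨⟨e⟩⟩ | ⟨⟨e⟩⟩
  · exact obstruction_K1_2K2.of_iso e
  · exact obstruction_2P3.of_iso e
  · exact obstruction_C4_2K1.of_iso e
  · exact obstruction_K1_compl_P3_K2.of_iso e
  · exact obstruction_K1_C5.of_iso e
  · exact obstruction_K1_banner.of_iso e
  · exact obstruction_K1_compl_P5.of_iso e

/-! ### Excluding the seven graphs -/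

/-- `G` contains none of the seven essential obstructions as an induced subgraph. -/
structure EssentialFree (G : SimpleGraph V) : Prop where
  k1_2k2 : ∀ v a b c d, G.Adj a b → G.Adj c d → ¬ G.Adj a c → ¬ G.Adj a d → ¬ G.Adj b c →
    ¬ G.Adj b d → ¬ G.Adj v a → ¬ G.Adj v b → ¬ G.Adj v c → ¬ G.Adj v d → False
  two_p3 : ∀ a b c d e f, G.Adj a b → G.Adj b c → ¬ G.Adj a c → a ≠ c →
    G.Adj d e → G.Adj e f → ¬ G.Adj d f → d ≠ f →
    ¬ G.Adj a d → ¬ G.Adj a e → ¬ G.Adj a f → ¬ G.Adj b d → ¬ G.Adj b e → ¬ G.Adj b f →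
    ¬ G.Adj c d → ¬ G.Adj c e → ¬ G.Adj c f → False
  c4_2k1 : ∀ a b c d u w, G.Adj a b → G.Adj b c → G.Adj c d → G.Adj d a → ¬ G.Adj a c →
    ¬ G.Adj b d → a ≠ c → b ≠ d → ¬ G.Adj u a → ¬ G.Adj u b → ¬ G.Adj u c → ¬ G.Adj u d →
    ¬ G.Adj w a → ¬ G.Adj w b → ¬ G.Adj w c → ¬ G.Adj w d → ¬ G.Adj u w → u ≠ w → False
  k1_compl_p3_k2 : ∀ v p q r k l, ¬ G.Adj p q → ¬ G.Adj q r → G.Adj p r → p ≠ q → q ≠ r →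
    ¬ G.Adj k l → k ≠ l → G.Adj p k → G.Adj p l → G.Adj q k → G.Adj q l → G.Adj r k →
    G.Adj r l → ¬ G.Adj v p → ¬ G.Adj v q → ¬ G.Adj v r → ¬ G.Adj v k → ¬ G.Adj v l → False
  k1_c5 : ∀ v a b c d e, G.Adj a b → G.Adj b c → G.Adj c d → G.Adj d e → G.Adj e a →
    ¬ G.Adj a c → ¬ G.Adj a d → ¬ G.Adj b d → ¬ G.Adj b e → ¬ G.Adj c e →
    ¬ G.Adj v a → ¬ G.Adj v b → ¬ G.Adj v c → ¬ G.Adj v d → ¬ G.Adj v e → False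
  k1_banner : ∀ v a b c d e, G.Adj a b → G.Adj b c → G.Adj c d → G.Adj d a → G.Adj c e →
    ¬ G.Adj a c → ¬ G.Adj b d → b ≠ d → ¬ G.Adj a e → ¬ G.Adj b e → ¬ G.Adj d e →
    ¬ G.Adj v a → ¬ G.Adj v b → ¬ G.Adj v c → ¬ G.Adj v d → ¬ G.Adj v e → False
  k1_compl_p5 : ∀ v a b c d e, ¬ G.Adj a b → ¬ G.Adj b c → ¬ G.Adj c d → ¬ G.Adj d e →
    G.Adj a c → G.Adj a d → G.Adj a e → G.Adj b d → G.Adj b e → G.Adj c e →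
    ¬ G.Adj v a → ¬ G.Adj v b → ¬ G.Adj v c → ¬ G.Adj v d → ¬ G.Adj v e → False

variable {G : SimpleGraph V}

theorem adj_iff_of_adj {P : Prop} {x y : V} (h : G.Adj x y) (hP : P) : G.Adj x y ↔ P :=
  iff_of_true h hP

theorem adj_iff_of_adj' {P : Prop} {x y : V} (h : G.Adj y x) (hP : P) : G.Adj x y ↔ P :=
  iff_of_true h.symm hP

theorem adj_iff_of_not {P : Prop} {x y : V} (h : ¬ G.Adj x y) (hP : ¬ P) : G.Adj x y ↔ P :=
  iff_of_false h hP

theorem adj_iff_of_not' {P : Prop} {x y : V} (h : ¬ G.Adj y x) (hP : ¬ P) : G.Adj x y ↔ P :=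
  iff_of_false (fun e => h e.symm) hP

theorem adj_iff_of_self {P : Prop} {x : V} (hP : ¬ P) : G.Adj x x ↔ P :=
  iff_of_false (G.loopless.irrefl x) hP

theorem EssentialFree.of_obstruction (hG : Obstruction G) (hE : ¬ IsEssential G) :
    EssentialFree G := by
  simp only [IsEssential, not_or] at hE
  obtain ⟨e1, e2, e3, e4, e5, e6, e7⟩ := hE
  refine ⟨?_, ?_, ?_, ?_, ?_, ?_, ?_⟩
  · intro v a b c d
    intros
    refine e1 (hG.iso_of_embedding obstruction_K1_2K2
      (Sum.elim ![v] (Sum.elim ![a, b] ![c, d])) ?_ ?_)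
    -- Vertices with different adjacencies are distinct. Pairs with the same neighbours, which occur
    -- in some of the later graphs, need the explicit inequalities in `EssentialFree`.
    · have : v ≠ a ∧ v ≠ b ∧ v ≠ c ∧ v ≠ d ∧ a ≠ b ∧ a ≠ c ∧ a ≠ d ∧ b ≠ c ∧ b ≠ d ∧ c ≠ d := by
        and_intros <;> grind [SimpleGraph.adj_comm, SimpleGraph.irrefl]
      rintro (i | i | i) (j | j | j) <;> fin_cases i <;> fin_cases j <;> simp <;> grind
    · rintro (i | i | i) (j | j | j) <;> fin_cases i <;> fin_cases j <;>
      first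
      | exact adj_iff_of_self (by decide)
      | exact adj_iff_of_adj (by assumption) (by decide)
      | exact adj_iff_of_adj' (by assumption) (by decide)
      | exact adj_iff_of_not (by assumption) (by decide)
      | exact adj_iff_of_not' (by assumption) (by decide)
  · intro a b c d e f
    intros
    refine e2 (hG.iso_of_embedding obstruction_2P3
      (Sum.elim ![a, b, c] ![d, e, f]) ?_ ?_)
    · have : a ≠ b ∧ a ≠ c ∧ a ≠ d ∧ a ≠ e ∧ a ≠ f ∧ b ≠ c ∧ b ≠ d ∧ b ≠ e ∧ b ≠ f ∧ c ≠ d ∧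
          c ≠ e ∧ c ≠ f ∧ d ≠ e ∧ d ≠ f ∧ e ≠ f := by
        and_intros <;> grind [SimpleGraph.adj_comm, SimpleGraph.irrefl]
      rintro (i | i) (j | j) <;> fin_cases i <;> fin_cases j <;> simp <;> grind
    · rintro (i | i) (j | j) <;> fin_cases i <;> fin_cases j <;>
      first
      | exact adj_iff_of_self (by decide)
      | exact adj_iff_of_adj (by assumption) (by decide)
      | exact adj_iff_of_adj' (by assumption) (by decide)
      | exact adj_iff_of_not (by assumption) (by decide)
      | exact adj_iff_of_not' (by assumption) (by decide)
  · intro a b c d u w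
    intros
    refine e3 (hG.iso_of_embedding obstruction_C4_2K1
      (Sum.elim ![a, b, c, d] (Sum.elim ![u] ![w])) ?_ ?_)
    · have : a ≠ b ∧ a ≠ c ∧ a ≠ d ∧ b ≠ c ∧ b ≠ d ∧ c ≠ d ∧ u ≠ a ∧ u ≠ b ∧ u ≠ c ∧ u ≠ d ∧
          w ≠ a ∧ w ≠ b ∧ w ≠ c ∧ w ≠ d ∧ u ≠ w := by
        and_intros <;> grind [SimpleGraph.adj_comm, SimpleGraph.irrefl]
      rintro (i | i | i) (j | j | j) <;> fin_cases i <;> fin_cases j <;> simp <;> grind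
    · rintro (i | i | i) (j | j | j) <;> fin_cases i <;> fin_cases j <;>
      first
      | exact adj_iff_of_self (by decide)
      | exact adj_iff_of_adj (by assumption) (by decide)
      | exact adj_iff_of_adj' (by assumption) (by decide)
      | exact adj_iff_of_not (by assumption) (by decide)
      | exact adj_iff_of_not' (by assumption) (by decide)
  · intro v p q r k l
    intros
    refine e4 (hG.iso_of_embedding obstruction_K1_compl_P3_K2
      (Sum.elim ![v] (Sum.elim ![p, q, r] ![k, l])) ?_ ?_)
    · have : v ≠ p ∧ v ≠ q ∧ v ≠ r ∧ v ≠ k ∧ v ≠ l ∧ p ≠ q ∧ p ≠ r ∧ p ≠ k ∧ p ≠ l ∧ q ≠ r ∧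
          q ≠ k ∧ q ≠ l ∧ r ≠ k ∧ r ≠ l ∧ k ≠ l := by
        and_intros <;> grind [SimpleGraph.adj_comm, SimpleGraph.irrefl]
      rintro (i | i | i) (j | j | j) <;> fin_cases i <;> fin_cases j <;> simp <;> grind
    · rintro (i | i | i) (j | j | j) <;> fin_cases i <;> fin_cases j <;>
      first
      | exact adj_iff_of_self (by decide)
      | exact adj_iff_of_adj (by assumption) (by decide)
      | exact adj_iff_of_adj' (by assumption) (by decide)
      | exact adj_iff_of_not (by assumption) (by decide)
      | exact adj_iff_of_not' (by assumption) (by decide)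
  · intro v a b c d e
    intros
    refine e5 (hG.iso_of_embedding obstruction_K1_C5 (Sum.elim ![v] ![a, b, c, d, e]) ?_ ?_)
    · have : v ≠ a ∧ v ≠ b ∧ v ≠ c ∧ v ≠ d ∧ v ≠ e ∧ a ≠ b ∧ a ≠ c ∧ a ≠ d ∧ a ≠ e ∧ b ≠ c ∧
          b ≠ d ∧ b ≠ e ∧ c ≠ d ∧ c ≠ e ∧ d ≠ e := by
        and_intros <;> grind [SimpleGraph.adj_comm, SimpleGraph.irrefl]
      rintro (i | i) (j | j) <;> fin_cases i <;> fin_cases j <;> simp <;> grind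
    · rintro (i | i) (j | j) <;> fin_cases i <;> fin_cases j <;>
      first
      | exact adj_iff_of_self (by decide)
      | exact adj_iff_of_adj (by assumption) (by decide)
      | exact adj_iff_of_adj' (by assumption) (by decide)
      | exact adj_iff_of_not (by assumption) (by decide)
      | exact adj_iff_of_not' (by assumption) (by decide)
  · intro v a b c d e
    intros
    refine e6 (hG.iso_of_embedding obstruction_K1_banner
      (Sum.elim ![v] ![a, b, c, d, e]) ?_ ?_)
    · have : v ≠ a ∧ v ≠ b ∧ v ≠ c ∧ v ≠ d ∧ v ≠ e ∧ a ≠ b ∧ a ≠ c ∧ a ≠ d ∧ a ≠ e ∧ b ≠ c ∧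
          b ≠ d ∧ b ≠ e ∧ c ≠ d ∧ c ≠ e ∧ d ≠ e := by
        and_intros <;> grind [SimpleGraph.adj_comm, SimpleGraph.irrefl]
      rintro (i | i) (j | j) <;> fin_cases i <;> fin_cases j <;> simp <;> grind
    · rintro (i | i) (j | j) <;> fin_cases i <;> fin_cases j <;>
      first
      | exact adj_iff_of_self (by decide)
      | exact adj_iff_of_adj (by assumption) (by decide)
      | exact adj_iff_of_adj' (by assumption) (by decide)
      | exact adj_iff_of_not (by assumption) (by decide)
      | exact adj_iff_of_not' (by assumption) (by decide)
  · intro v a b c d e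
    intros
    refine e7 (hG.iso_of_embedding obstruction_K1_compl_P5
      (Sum.elim ![v] ![a, b, c, d, e]) ?_ ?_)
    · have : v ≠ a ∧ v ≠ b ∧ v ≠ c ∧ v ≠ d ∧ v ≠ e ∧ a ≠ b ∧ a ≠ c ∧ a ≠ d ∧ a ≠ e ∧ b ≠ c ∧
          b ≠ d ∧ b ≠ e ∧ c ≠ d ∧ c ≠ e ∧ d ≠ e := by
        and_intros <;> grind [SimpleGraph.adj_comm, SimpleGraph.irrefl]
      rintro (i | i) (j | j) <;> fin_cases i <;> fin_cases j <;> simp <;> grind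
    · rintro (i | i) (j | j) <;> fin_cases i <;> fin_cases j <;>
      first
      | exact adj_iff_of_self (by decide)
      | exact adj_iff_of_adj (by assumption) (by decide)
      | exact adj_iff_of_adj' (by assumption) (by decide)
      | exact adj_iff_of_not (by assumption) (by decide)
      | exact adj_iff_of_not' (by assumption) (by decide)

/-! ### Induced paths, heavy cliques and split graphs -/

/-- `a`, `b`, `c`, `d` induce, in this order, a path on four vertices. -/
structure IsP4 (G : SimpleGraph V) (a b c d : V) : Prop where
  ab : G.Adj a b
  bc : G.Adj b c
  cd : G.Adj c d
  ac : ¬ G.Adj a c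
  bd : ¬ G.Adj b d
  ad : ¬ G.Adj a d

theorem IsP4.inducesP4 {a b c d : V} (h : IsP4 G a b c d) : InducesP4 G {a, b, c, d} := by
  obtain ⟨h1, h2, h3, h4, h5, h6⟩ := h
  have hne : a ≠ b ∧ a ≠ c ∧ a ≠ d ∧ b ≠ c ∧ b ≠ d ∧ c ≠ d := by
    and_intros <;> grind [SimpleGraph.adj_comm, SimpleGraph.irrefl]
  let f : Fin 4 → ({a, b, c, d} : Set V) :=
    ![⟨a, by simp⟩, ⟨b, by simp⟩, ⟨c, by simp⟩, ⟨d, by simp⟩]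
  have hf : Function.Bijective f := by
    constructor
    · intro i j
      fin_cases i <;> fin_cases j <;> simp [f] <;> grind
    · rintro ⟨x, rfl | rfl | rfl | rfl⟩
      · exact ⟨0, rfl⟩
      · exact ⟨1, rfl⟩
      · exact ⟨2, rfl⟩
      · exact ⟨3, rfl⟩
  refine ⟨RelIso.symm ⟨Equiv.ofBijective f hf, ?_⟩⟩
  intro i j
  change G.Adj (f i) (f j) ↔ _
  fin_cases i <;> fin_cases j <;>
  first
  | exact adj_iff_of_self (by decide)
  | exact adj_iff_of_adj (by assumption) (by decide)
  | exact adj_iff_of_adj' (by assumption) (by decide)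
  | exact adj_iff_of_not (by assumption) (by decide)
  | exact adj_iff_of_not' (by assumption) (by decide)

/-- A weighted maximum clique, where heavier vertices have larger degree and two vertices always
outweigh one. -/
theorem exists_heavy_clique [Finite V] (G : SimpleGraph V) : ∃ K : Set V,
    (∀ x ∈ K, ∀ y ∈ K, x ≠ y → G.Adj x y) ∧
    (∀ x ∉ K, ∃ k ∈ K, ¬ G.Adj x k) ∧
    (∀ x ∉ K, ∀ k ∈ K, (∀ j ∈ K, j ≠ k → G.Adj x j) → ∀ y, G.Adj x y → ¬ G.Adj k y →
      ∃ z, G.Adj k z ∧ ¬ G.Adj x z) ∧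
    (∀ x ∉ K, ∀ y ∉ K, ∀ k ∈ K, G.Adj x y → (∀ j ∈ K, j ≠ k → G.Adj x j) →
      (∀ j ∈ K, j ≠ k → G.Adj y j) → False) := by
  classical
  have := Fintype.ofFinite V
  -- Degrees are below `|V|`, so one vertex weighs less than `2|V|` and two weigh at least that
  -- much.
  let w : V → ℕ := fun x => Fintype.card V + G.degree x
  let C : Finset (Finset V) :=
    Finset.univ.filter (fun K : Finset V => ∀ x ∈ K, ∀ y ∈ K, x ≠ y → G.Adj x y)
  have memC : ∀ K : Finset V, K ∈ C ↔ ∀ x ∈ K, ∀ y ∈ K, x ≠ y → G.Adj x y := by simp [C]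
  obtain ⟨K, hK, hmax⟩ := C.exists_max_image (fun K => ∑ x ∈ K, w x) ⟨∅, by simp [C]⟩
  have hcl := (memC K).1 hK
  have wpos : ∀ x, G.degree x < w x := fun x => by
    have : 0 < Fintype.card V := Fintype.card_pos_iff.2 ⟨x⟩
    simp only [w]; omega
  have exch : ∀ x ∉ K, ∀ k ∈ K, (∀ j ∈ K, j ≠ k → G.Adj x j) →
      (insert x (K.erase k)) ∈ C ∧ ∑ v ∈ insert x (K.erase k), w v + w k = ∑ v ∈ K, w v + w x := by
    intro x hx k hk hj
    constructor
    · rw [memC]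
      intro p hp q hq hpq
      simp only [Finset.mem_insert, Finset.mem_erase] at hp hq
      rcases hp with rfl | ⟨hp1, hp2⟩ <;> rcases hq with rfl | ⟨hq1, hq2⟩
      · exact absurd rfl hpq
      · exact hj q hq2 hq1
      · exact (hj p hp2 hp1).symm
      · exact hcl p hp2 q hq2 hpq
    · rw [Finset.sum_insert (by simp [hx]), ← Finset.sum_erase_add K w hk]
      ring
  refine ⟨K, by simpa using hcl, ?_, ?_, ?_⟩
  · intro x hx
    have hx : x ∉ K := by simpa using hx
    by_contra! hall
    have h1 : insert x K ∈ C := by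
      rw [memC]
      intro p hp q hq hpq
      simp only [Finset.mem_insert] at hp hq
      rcases hp with rfl | hp <;> rcases hq with rfl | hq
      · exact absurd rfl hpq
      · exact hall q hq
      · exact (hall p hp).symm
      · exact hcl p hp q hq hpq
    have h2 := hmax _ h1
    simp only [Finset.sum_insert hx] at h2
    have := wpos x
    omega
  · intro x hx k hk hj y hxy hky
    have hx : x ∉ K := by simpa using hx
    have hk : k ∈ K := by simpa using hk
    obtain ⟨h1, h2⟩ := exch x hx k hk (by simpa using hj)
    have h3 := hmax _ h1
    by_contra! hall
    -- Otherwise `x` has larger degree than `k`, and swapping them gives a heavier clique.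
    have h4 : G.neighborFinset k ⊂ G.neighborFinset x := by
      refine (Finset.ssubset_iff_of_subset ?_).2 ⟨y, by simpa using hxy, by simpa using hky⟩
      intro z hz
      simpa using hall z (by simpa using hz)
    have h5 := Finset.card_lt_card h4
    rw [card_neighborFinset_eq_degree, card_neighborFinset_eq_degree] at h5
    simp only [w] at h2 h3
    omega
  · intro x hx y hy k hk hxy hjx hjy
    have hx : x ∉ K := by simpa using hx
    have hy : y ∉ K := by simpa using hy
    have hk : k ∈ K := by simpa using hk
    obtain ⟨h1, h2⟩ := exch x hx k hk (by simpa using hjx)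
    have hyx : y ∉ insert x (K.erase k) := by simp [hxy.ne', hy]
    have h3 : insert y (insert x (K.erase k)) ∈ C := by
      rw [memC] at h1 ⊢
      have hall : ∀ p ∈ insert x (K.erase k), G.Adj y p := by
        intro p hp
        simp only [Finset.mem_insert, Finset.mem_erase] at hp
        rcases hp with rfl | ⟨hp1, hp2⟩
        · exact hxy.symm
        · exact hjy p hp2 hp1
      intro p hp q hq hpq
      rcases Finset.mem_insert.1 hp with hp' | hp' <;>
        rcases Finset.mem_insert.1 hq with hq' | hq'
      · exact absurd (hp'.trans hq'.symm) hpq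
      · exact hp' ▸ hall q hq'
      · exact hq' ▸ (hall p hp').symm
      · exact h1 p hp' q hq' hpq
    have h4 := hmax _ h3
    rw [Finset.sum_insert hyx] at h4
    have h5 : G.degree k < Fintype.card V := G.degree_lt_card_verts k
    simp only [w] at h2 h4
    omega

/-- Földes–Hammer: a graph without induced `2K₂`, `C₄`, `C₅` is a split graph. -/
theorem exists_split_partition [Finite V]
    (h2K2 : ∀ a b c d, G.Adj a b → G.Adj c d → ¬ G.Adj a c → ¬ G.Adj a d → ¬ G.Adj b c →
      ¬ G.Adj b d → False)
    (hC4 : ∀ a b c d, G.Adj a b → G.Adj b c → G.Adj c d → G.Adj d a → ¬ G.Adj a c →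
      ¬ G.Adj b d → a ≠ c → b ≠ d → False)
    (hC5 : ∀ a b c d e, G.Adj a b → G.Adj b c → G.Adj c d → G.Adj d e → G.Adj e a →
      ¬ G.Adj a c → ¬ G.Adj a d → ¬ G.Adj b d → ¬ G.Adj b e → ¬ G.Adj c e → False) :
    ∃ B : Set V, (∀ x ∈ B, ∀ y ∈ B, x ≠ y → G.Adj x y) ∧
      ∀ x ∉ B, ∀ y ∉ B, ¬ G.Adj x y := by
  obtain ⟨K, hcl, hm, hdeg, hpair⟩ := exists_heavy_clique G
  refine ⟨K, hcl, ?_⟩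
  have key : ∀ x ∉ K, ∀ y ∉ K, G.Adj x y → (∀ k ∈ K, ¬ G.Adj x k → ¬ G.Adj y k) → False := by
    intro x hx y hy hxy hsub
    obtain ⟨k, hk, hxk⟩ := hm x hx
    have hyk := hsub k hk hxk
    -- A second vertex of `K` missed by `x` would form, with `k`, an edge inducing a `2K₂` with `x
    -- y`.
    have hjx : ∀ j ∈ K, j ≠ k → G.Adj x j := by
      intro j hj hjk
      by_contra hxj
      exact h2K2 x y j k hxy (hcl j hj k hk hjk) hxj hxk (hsub j hj hxj) hyk
    obtain ⟨z, hkz, hxz⟩ := hdeg x hx k hk hjx y hxy (fun h => hyk h.symm)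
    have hyz : G.Adj y z := by
      by_contra hyz
      exact h2K2 x y k z hxy hkz hxk hxz hyk hyz
    -- Replacing `k` by both `x` and `y` would enlarge the clique, unless `y` misses another vertex
    -- `j`; then `z` closes a `C₄` or a `C₅`.
    refine hpair x hx y hy k hk hxy hjx ?_
    intro j hj hjk
    by_contra hyj
    have hkj := hcl k hk j hj hjk.symm
    have hjx' := (hjx j hj hjk).symm
    by_cases hzj : G.Adj z j
    · exact hC4 x y z j hxy hyz hzj hjx' hxz hyj (fun e => hxk (e ▸ hkz.symm))
        (fun e => hy (e ▸ hj))
    · exact hC5 x y z k j hxy hyz hkz.symm hkj hjx' hxz hxk hyk hyj hzj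
  intro x hx y hy hxy
  by_cases h1 : ∀ k ∈ K, ¬ G.Adj x k → ¬ G.Adj y k
  · exact key x hx y hy hxy h1
  by_cases h2 : ∀ k ∈ K, ¬ G.Adj y k → ¬ G.Adj x k
  · exact key y hy x hx hxy.symm h2
  push Not at h1 h2
  obtain ⟨k, hk, hxk, hyk⟩ := h1
  obtain ⟨l, hl, hyl, hxl⟩ := h2
  have hkl : k ≠ l := fun e => hxk (e ▸ hxl)
  exact hC4 x y k l hxy hyk (hcl k hk l hl hkl) hxl.symm hxk hyl (fun e => hx (e ▸ hk))
    (fun e => hy (e ▸ hl))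

/-! ### Seinsche's theorem on graphs without induced `P₄` -/

/-- `X` and its complement partition `S` into two nonempty parts without edges between them. -/
def Separates (G : SimpleGraph V) (X S : Set V) : Prop :=
  (∃ x ∈ S, x ∈ X) ∧ (∃ y ∈ S, y ∉ X) ∧ ∀ x ∈ S, ∀ y ∈ S, x ∈ X → y ∉ X → ¬ G.Adj x y

theorem Separates.compl {X S : Set V} (h : Separates G X S) : Separates G Xᶜ S := by
  obtain ⟨⟨p, hp, hpX⟩, ⟨q, hq, hqX⟩, hX⟩ := h
  exact ⟨⟨q, hq, hqX⟩, ⟨p, hp, fun h => h hpX⟩, fun x hx y hy hxX hyX hxy =>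
    hX y hy x hx (not_not.1 hyX) hxX hxy.symm⟩

theorem Separates.insert_of_not_adj (h : ∀ a b c d, ¬ IsP4 G a b c d) {X S : Set V} {v w : V}
    (hX : Separates G X S) (hv : v ∉ S) (hw : w ∈ S) (hwX : w ∈ X) (hvw : ¬ G.Adj v w) :
    ∃ Y, Separates G Y (insert v S) := by
  obtain ⟨-, ⟨q, hq, hqX⟩, hX⟩ := hX
  by_cases hq' : ∃ q ∈ S, q ∉ X ∧ G.Adj v q
  · obtain ⟨q, hq, hqX, hvq⟩ := hq'
    -- The non-neighbours of `v` in `X` split off: an edge from one of them to a neighbour `y` of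
    -- `v` in `X` would give the path `x y v q`.
    refine ⟨{x | x ∈ S ∧ x ∈ X ∧ ¬ G.Adj v x}, ⟨w, .inr hw, hw, hwX, hvw⟩,
      ⟨v, .inl rfl, fun h => hv h.1⟩, ?_⟩
    rintro x - y hy ⟨hxS, hxX, hvx⟩ hyn hxy
    rcases hy with rfl | hy
    · exact hvx hxy.symm
    by_cases hyX : y ∈ X
    · have hvy : G.Adj v y := by
        by_contra hvy
        exact hyn ⟨hy, hyX, hvy⟩
      exact h x y v q ⟨hxy, hvy.symm, hvq, fun e => hvx e.symm, hX y hy q hq hyX hqX,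
        hX x hxS q hq hxX hqX⟩
    · exact hX x hxS y hy hxX hyX hxy
  · refine ⟨{x | x ∈ S ∧ x ∉ X}, ⟨q, .inr hq, hq, hqX⟩, ⟨v, .inl rfl, fun h => hv h.1⟩, ?_⟩
    rintro x - y hy ⟨hxS, hxX⟩ hyn hxy
    rcases hy with rfl | hy
    · exact hq' ⟨x, hxS, hxX, hxy.symm⟩
    · have hyX : y ∈ X := by
        by_contra hyX
        exact hyn ⟨hy, hyX⟩
      exact hX y hy x hxS hyX hxX hxy.symm

theorem Separates.insert (h : ∀ a b c d, ¬ IsP4 G a b c d) {X S : Set V} {v : V}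
    (hX : Separates G X S) (hv : v ∉ S) :
    ∃ Y, Separates G Y (insert v S) ∨ Separates Gᶜ Y (insert v S) := by
  by_cases hw : ∃ w ∈ S, ¬ G.Adj v w
  · obtain ⟨w, hw, hvw⟩ := hw
    by_cases hwX : w ∈ X
    · obtain ⟨Y, hY⟩ := hX.insert_of_not_adj h hv hw hwX hvw
      exact ⟨Y, .inl hY⟩
    · obtain ⟨Y, hY⟩ := hX.compl.insert_of_not_adj h hv hw hwX hvw
      exact ⟨Y, .inl hY⟩
  · push Not at hw
    obtain ⟨⟨p, hp, -⟩, -⟩ := hX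
    refine ⟨{v}, .inr ⟨⟨v, .inl rfl, rfl⟩, ⟨p, .inr hp, fun e => hv (e ▸ hp)⟩, ?_⟩⟩
    rintro x - y hy rfl hyv
    rcases hy with rfl | hy
    · exact absurd rfl hyv
    · simp [compl_adj, hw y hy]

/-- The path `P₄` is self-complementary, which lets the induction in Seinsche's theorem treat a
graph and its complement alike. -/
theorem IsP4.of_compl {a b c d : V} (h : IsP4 Gᶜ a b c d) : IsP4 G b d a c := by
  obtain ⟨h1, h2, h3, h4, h5, h6⟩ := h
  simp only [compl_adj] at *
  constructor <;> grind [SimpleGraph.adj_comm, SimpleGraph.irrefl]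

/-- Seinsche: a set of at least two vertices in a graph without induced `P₄` is disconnected in
the graph or in its complement. -/
theorem exists_separates (h : ∀ a b c d, ¬ IsP4 G a b c d) (S : Finset V) :
    S.Nontrivial → ∃ X : Set V, Separates G X S ∨ Separates Gᶜ X S := by
  classical
  induction S using Finset.induction_on with
  | empty => intro h; simp at h
  | insert v S hv ih =>
    intro hvS
    rw [Finset.coe_insert]
    by_cases hS : S.Nontrivial
    · obtain ⟨X, hX | hX⟩ := ih hS
      · exact hX.insert h (by simpa using hv)
      · have := hX.insert (fun a b c d h' => h _ _ _ _ h'.of_compl) (v := v) (by simpa using hv)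
        simpa [or_comm] using this
    · obtain ⟨w, hw, hne⟩ := hvS.exists_ne v
      have hwS : w ∈ S := by simpa [hne] using hw
      have hS' : ∀ x ∈ S, x = w := fun x hx => by
        by_contra hxw
        exact hS ⟨x, hx, w, hwS, hxw⟩
      refine ⟨{v}, ?_⟩
      have hall : ∀ H : SimpleGraph V, ¬ H.Adj v w → Separates H {v} (Insert.insert v (S : Set V)) := by
        intro H hH
        refine ⟨⟨v, .inl rfl, rfl⟩, ⟨w, .inr hwS, hne⟩, ?_⟩
        rintro x - y hy rfl hyx
        rcases hy with rfl | hy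
        · exact absurd rfl hyx
        · rwa [hS' y hy]
      by_cases hvw : G.Adj v w
      · exact .inr (hall _ (by simp [compl_adj, hvw]))
      · exact .inl (hall _ hvw)

/-! ### Minimal obstructions are connected and co-connected -/

/-- Joining polar graphs gives a polar graph. -/
theorem Obstruction.not_separates_compl (hG : Obstruction G) (X : Set V) :
    ¬ Separates Gᶜ X Set.univ := by
  rintro ⟨⟨p, -, hp⟩, ⟨q, -, hq⟩, hX⟩
  have hadj : ∀ x y, x ∈ X → y ∉ X → G.Adj x y := by
    intro x y hx hy
    have h := hX x trivial y trivial hx hy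
    by_contra hxy
    exact h ⟨fun e => hy (e ▸ hx), hxy⟩
  obtain ⟨B, b1, b2⟩ := hG.2 X (fun h => hq (h ▸ trivial))
  obtain ⟨C, c1, c2⟩ := hG.2 Xᶜ (fun h => (h ▸ Set.mem_univ p : p ∈ Xᶜ) hp)
  refine hG.1 ⟨{x | (x ∈ X ∧ x ∈ B) ∨ (x ∉ X ∧ x ∈ C)}, ?_, ?_⟩
  · intro x _ y _ hx hy hne
    have := b1 x; have := c1 x; have := hadj x y; have := hadj y x
    simp only [Set.mem_ofPred_eq, Set.mem_compl_iff] at *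
    grind [SimpleGraph.adj_comm]
  · intro x _ y _ z _ hx hy hz hxy hyz
    have h1 := hadj x y; have h2 := hadj y x; have h3 := hadj y z; have h4 := hadj z y
    simp only [SimpleGraph.adj_comm G y x, SimpleGraph.adj_comm G z y] at h2 h4
    simp only [Set.mem_ofPred_eq] at hx hy hz
    by_cases hyX : y ∈ X
    · have hxX : x ∈ X := by_contra fun h => hxy (h2 hyX h)
      have hzX : z ∈ X := by_contra fun h => hyz (h3 hyX h)
      exact b2 x hxX y hyX z hzX (fun h => hx (.inl ⟨hxX, h⟩)) (fun h => hy (.inl ⟨hyX, h⟩))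
        (fun h => hz (.inl ⟨hzX, h⟩)) hxy hyz
    · have hxX : x ∉ X := fun h => hxy (h1 h hyX)
      have hzX : z ∉ X := fun h => hyz (h4 h hyX)
      exact c2 x hxX y hyX z hzX (fun h => hx (.inr ⟨hxX, h⟩)) (fun h => hy (.inr ⟨hyX, h⟩))
        (fun h => hz (.inr ⟨hzX, h⟩)) hxy hyz

/-- If `v` is isolated and `G` contains an induced `C₄`, then `G - v` is complete multipartite. -/
theorem EssentialFree.not_adj_trans_of_c4 (hE : EssentialFree G) {v : V} (hv : ∀ x, ¬ G.Adj v x)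
    {a b c d : V} (hab : G.Adj a b) (hbc : G.Adj b c) (hcd : G.Adj c d) (hda : G.Adj d a)
    (hac : ¬ G.Adj a c) (hbd : ¬ G.Adj b d) (hac' : a ≠ c) (hbd' : b ≠ d)
    (x y z : V) (hx : x ≠ v) (hy : y ≠ v) (hz : z ≠ v)
    (hxy : ¬ G.Adj x y) (hyz : ¬ G.Adj y z) : ¬ G.Adj x z := by
  -- Together with `v`, a vertex seeing none of the cycle gives `C₄ + 2K₁`, one neighbour gives `K₁
  -- + P`, two consecutive ones `K₁` plus the complement of `P₅`, and three `K₁` plus the complement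
  -- of `P₃ + K₂`.
  have type : ∀ u, u ≠ v → (G.Adj u a ∧ G.Adj u b ∧ G.Adj u c ∧ G.Adj u d) ∨
      (¬ G.Adj u a ∧ G.Adj u b ∧ ¬ G.Adj u c ∧ G.Adj u d) ∨
      (G.Adj u a ∧ ¬ G.Adj u b ∧ G.Adj u c ∧ ¬ G.Adj u d) := by
    intro u hu
    have i0 := hE.c4_2k1 a b c d v u hab hbc hcd hda hac hbd hac' hbd' (hv _) (hv _) (hv _) (hv _)
    have i1 := hE.k1_banner v a b c d u hab hbc hcd hda
    have i2 := hE.k1_banner v b c d a u hbc hcd hda hab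
    have i3 := hE.k1_banner v c d a b u hcd hda hab hbc
    have i4 := hE.k1_banner v d a b c u hda hab hbc hcd
    have j1 := hE.k1_compl_p5 v a c u d b hac
    have j2 := hE.k1_compl_p5 v b d u a c hbd
    have j3 := hE.k1_compl_p5 v c a u b d (fun h => hac h.symm)
    have j4 := hE.k1_compl_p5 v d b u c a (fun h => hbd h.symm)
    have k1 := hE.k1_compl_p3_k2 v u d b a c
    have k2 := hE.k1_compl_p3_k2 v u a c b d
    have k3 := hE.k1_compl_p3_k2 v u b d a c
    have k4 := hE.k1_compl_p3_k2 v u c a b d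
    simp only [hv, not_false_eq_true, forall_const] at *
    by_cases h1 : G.Adj u a <;> by_cases h2 : G.Adj u b <;> by_cases h3 : G.Adj u c <;>
      by_cases h4 : G.Adj u d <;> grind [SimpleGraph.adj_comm, SimpleGraph.irrefl]
  -- Otherwise `p` is a pendant vertex at `b` of the cycle `q a b c`, a banner.
  have cross : ∀ p q, p ≠ v → q ≠ v → ¬ G.Adj p a → ¬ G.Adj q b → G.Adj p q := by
    intro p q hp hq hpa hqb
    have tp := type p hp
    have tq := type q hq
    have := hE.k1_banner v q a b c p
    simp only [hv, not_false_eq_true, forall_const] at *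
    grind [SimpleGraph.adj_comm]
  intro hxz
  have hxy' : x ≠ y := fun e => hyz (e ▸ hxz)
  have hyz' : y ≠ z := fun e => hxy (e ▸ hxz)
  have tx := type x hx
  have ty := type y hy
  have tz := type z hz
  have hya : G.Adj y a := by
    by_contra hya
    have hxb : G.Adj x b := by_contra fun h => hxy (cross y x hy hx hya h).symm
    have hzb : G.Adj z b := by_contra fun h => hyz (cross y z hy hz hya h)
    have := hE.k1_compl_p3_k2 v x y z b d hxy hyz hxz hxy' hyz' hbd hbd' hxb
    simp only [hv, not_false_eq_true, forall_const] at this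
    grind
  have hyb : G.Adj y b := by
    by_contra hyb
    have hxa : G.Adj x a := by_contra fun h => hxy (cross x y hx hy h hyb)
    have hza : G.Adj z a := by_contra fun h => hyz (cross z y hz hy h hyb).symm
    have := hE.k1_compl_p3_k2 v x y z a c hxy hyz hxz hxy' hyz' hac hac' hxa
    simp only [hv, not_false_eq_true, forall_const] at this
    grind
  -- Now `y` sees the whole cycle. If `x` and `z` both see `a`, `c` or both see `b`, `d`, then `m1`
  -- or `m2` applies; otherwise one sees only `a`, `c` and the other only `b`, `d`, giving the
  -- complement of `P₅`.
  have m1 := hE.k1_compl_p3_k2 v x y z a c hxy hyz hxz hxy' hyz' hac hac'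
  have m2 := hE.k1_compl_p3_k2 v x y z b d hxy hyz hxz hxy' hyz' hbd hbd'
  have m3 := hE.k1_compl_p5 v a x y z b
  have m4 := hE.k1_compl_p5 v a z y x b
  simp only [hv, not_false_eq_true, forall_const] at m1 m2 m3 m4
  grind [SimpleGraph.adj_comm]

/-- A disconnected minimal obstruction is essential. -/
theorem Obstruction.not_separates [Finite V] (hG : Obstruction G) (hE : EssentialFree G)
    (X : Set V) : ¬ Separates G X Set.univ := by
  intro hX
  by_cases hv : ∃ v, ∀ x, ¬ G.Adj v x
  · obtain ⟨v, hv⟩ := hv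
    by_cases hC4 : ∃ a b c d, G.Adj a b ∧ G.Adj b c ∧ G.Adj c d ∧ G.Adj d a ∧ ¬ G.Adj a c ∧
        ¬ G.Adj b d ∧ a ≠ c ∧ b ≠ d
    · obtain ⟨a, b, c, d, hab, hbc, hcd, hda, hac, hbd, hac', hbd'⟩ := hC4
      refine hG.1 ⟨{v}, fun x _ y _ hx hy hne => absurd (hx.trans hy.symm) hne, ?_⟩
      intro x _ y _ z _ hx hy hz
      exact hE.not_adj_trans_of_c4 hv hab hbc hcd hda hac hbd hac' hbd' x y z hx hy hz
    · obtain ⟨B, b1, b2⟩ := exists_split_partition (G := G)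
        (fun a b c d h1 h2 h3 h4 h5 h6 =>
          hE.k1_2k2 v a b c d h1 h2 h3 h4 h5 h6 (hv _) (hv _) (hv _) (hv _))
        (fun a b c d h1 h2 h3 h4 h5 h6 h7 h8 => hC4 ⟨a, b, c, d, h1, h2, h3, h4, h5, h6, h7, h8⟩)
        (fun a b c d e h1 h2 h3 h4 h5 h6 h7 h8 h9 h10 =>
          hE.k1_c5 v a b c d e h1 h2 h3 h4 h5 h6 h7 h8 h9 h10 (hv _) (hv _) (hv _) (hv _) (hv _))
      exact hG.1 ⟨B, fun x _ y _ hx hy => b1 x hx y hy,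
        fun x _ y _ z _ hx _ hz _ _ => b2 x hx z hz⟩
  · push Not at hv
    -- The other side contains an edge `p q`; with an edge `x z` and a common non-neighbour `y` it
    -- would form `K₁ + 2K₂`.
    have multi : ∀ X, Separates G X Set.univ → ∀ x ∈ X, ∀ y ∈ X, ∀ z ∈ X,
        ¬ G.Adj x y → ¬ G.Adj y z → ¬ G.Adj x z := by
      rintro X ⟨-, ⟨p, -, hp⟩, hX⟩ x hx y hy z hz hxy hyz hxz
      obtain ⟨q, hpq⟩ := hv p
      have hq : q ∉ X := fun h => hX q trivial p trivial h hp hpq.symm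
      exact hE.k1_2k2 y x z p q hxz hpq (hX x trivial p trivial hx hp)
        (hX x trivial q trivial hx hq) (hX z trivial p trivial hz hp)
        (hX z trivial q trivial hz hq) (fun h => hxy h.symm) hyz
        (hX y trivial p trivial hy hp) (hX y trivial q trivial hy hq)
    have path : ∀ X, Separates G X Set.univ → (∃ x ∈ X, ∃ y ∈ X, x ≠ y ∧ ¬ G.Adj x y) →
        ∃ a ∈ X, ∃ b ∈ X, ∃ c ∈ X, G.Adj a b ∧ G.Adj b c ∧ ¬ G.Adj a c ∧ a ≠ c := by
      rintro X hX ⟨x, hx, y, hy, hne, hxy⟩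
      obtain ⟨z, hxz⟩ := hv x
      have hz : z ∈ X := by
        by_contra hz
        exact hX.2.2 x trivial z trivial hx hz hxz
      have hzy : G.Adj z y := by
        by_contra hzy
        exact multi X hX x hx y hy z hz hxy (fun h => hzy h.symm) hxz
      exact ⟨x, hx, z, hz, y, hy, hxz, hzy, hxy, hne⟩
    have fin : ∀ X, Separates G X Set.univ → (∀ x ∈ X, ∀ y ∈ X, x ≠ y → G.Adj x y) → False := by
      intro X hX hcl
      exact hG.1 ⟨X, fun x _ y _ hx hy hne => hcl x hx y hy hne,
        fun x _ y _ z _ hx hy hz => multi Xᶜ hX.compl x hx y hy z hz⟩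
    by_cases h1 : ∃ x ∈ X, ∃ y ∈ X, x ≠ y ∧ ¬ G.Adj x y
    · by_cases h2 : ∃ x ∈ Xᶜ, ∃ y ∈ Xᶜ, x ≠ y ∧ ¬ G.Adj x y
      · obtain ⟨a, ha, b, hb, c, hc, hab, hbc, hac, hne⟩ := path X hX h1
        obtain ⟨d, hd, e, he, f, hf, hde, hef, hdf, hne'⟩ := path Xᶜ hX.compl h2
        have hX' : ∀ x ∈ X, ∀ y ∈ Xᶜ, ¬ G.Adj x y :=
          fun x hx y hy => hX.2.2 x trivial y trivial hx hy
        exact hE.two_p3 a b c d e f hab hbc hac hne hde hef hdf hne' (hX' a ha d hd)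
          (hX' a ha e he) (hX' a ha f hf) (hX' b hb d hd) (hX' b hb e he) (hX' b hb f hf)
          (hX' c hc d hd) (hX' c hc e he) (hX' c hc f hf)
      · push Not at h2
        exact fin _ hX.compl h2
    · push Not at h1
      exact fin _ hX h1

/-! ### Homogeneous sets around an induced path -/

/-- A minimal obstruction has no homogeneous set `U` that contains an induced `P₄` and has both
vertices complete to it and vertices anticomplete to it. -/
theorem Obstruction.not_homogeneous (hG : Obstruction G) {T N : Set V}
    (hTN : ∀ x ∈ T, x ∉ N) {t n : V} (ht : t ∈ T) (hn : n ∈ N)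
    (hT : ∀ x ∈ T, ∀ u, u ∉ T → u ∉ N → G.Adj x u)
    (hN : ∀ x ∈ N, ∀ u, u ∉ T → u ∉ N → ¬ G.Adj x u)
    {a b c d : V} (hP : IsP4 G a b c d) (ha : a ∉ T ∧ a ∉ N) (hb : b ∉ T ∧ b ∉ N)
    (hc : c ∉ T ∧ c ∉ N) (hd : d ∉ T ∧ d ∉ N) : False := by
  obtain ⟨hab, hbc, hcd, hac, hbd, had⟩ := hP
  have hne : a ≠ d := fun e => hac (e ▸ hcd.symm)
  obtain ⟨B, b1, b2⟩ := hG.2 {t}ᶜ (fun h => (h ▸ Set.mem_univ t : t ∈ ({t}ᶜ : Set V)) rfl)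
  have mem : ∀ x, x ∉ T → x ∈ ({t}ᶜ : Set V) := fun x hx e => hx (e ▸ ht)
  -- If `n` were in the clique, the clique would miss the homogeneous set `U`, which is not complete
  -- multipartite because it contains `a`, `b`, `d`. Once `n` is outside, it is a common
  -- non-neighbour of `U`, so `U \ B` is independent.
  have hnB : n ∉ B := by
    intro hnB
    have hU : ∀ u, u ∉ T → u ∉ N → u ∉ B := fun u hu hu' huB =>
      hN n hn u hu hu' (b1 n (mem n fun h => hTN n h hn) u (mem u hu) hnB huB
        (fun e => hu' (e ▸ hn)))
    exact b2 a (mem a ha.1) d (mem d hd.1) b (mem b hb.1) (hU a ha.1 ha.2) (hU d hd.1 hd.2)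
      (hU b hb.1 hb.2) had (fun h => hbd h.symm) hab
  have hind : ∀ x y, x ∉ T → x ∉ N → y ∉ T → y ∉ N → x ∉ B → y ∉ B → ¬ G.Adj x y :=
    fun x y hx hx' hy hy' hxB hyB => b2 x (mem x hx) n (mem n fun h => hTN n h hn) y (mem y hy)
      hxB hnB hyB (fun h => hN n hn x hx hx' h.symm) (hN n hn y hy hy')
  have hcl : ∀ x y, x ∉ T → y ∉ T → x ∈ B → y ∈ B → x ≠ y → G.Adj x y :=
    fun x y hx hy => b1 x (mem x hx) y (mem y hy)
  -- A second partition, now deleting a vertex of `U`. What remains of the path, `a b + d`, is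
  -- neither complete multipartite nor a clique, so `C` contains a vertex `w` of `U` and omits a
  -- vertex `u`.
  obtain ⟨C, c1, c2⟩ := hG.2 {c}ᶜ (fun h => (h ▸ Set.mem_univ c : c ∈ ({c}ᶜ : Set V)) rfl)
  have hac' : a ≠ c := fun e => had (e ▸ hcd)
  have mem : ∀ x, x ≠ c → x ∈ ({c}ᶜ : Set V) := fun x hx => hx
  have hCU : ∃ w, w ∉ T ∧ w ∉ N ∧ w ≠ c ∧ w ∈ C := by
    by_contra! hall
    exact c2 a (mem a hac') d (mem d hcd.ne') b (mem b hbc.ne)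
      (hall a ha.1 ha.2 hac') (hall d hd.1 hd.2 hcd.ne') (hall b hb.1 hb.2 hbc.ne) had
      (fun h => hbd h.symm) hab
  obtain ⟨w, hwT, hwN, hwc, hwC⟩ := hCU
  have hCN : ∀ x ∈ N, x ∉ C := fun x hx hxC => hN x hx w hwT hwN
    (c1 x (mem x fun e => hc.2 (e ▸ hx)) w (mem w hwc) hxC hwC (fun e => hwN (e ▸ hx)))
  have hu : ∃ u, u ∉ T ∧ u ∉ N ∧ u ≠ c ∧ u ∉ C := by
    by_contra! hall
    exact had (c1 a (mem a hac') d (mem d hcd.ne') (hall a ha.1 ha.2 hac')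
      (hall d hd.1 hd.2 hcd.ne') hne)
  obtain ⟨u, huT, huN, huc, huC⟩ := hu
  -- The two partitions are glued: `C` decides on `T`, `B` decides on `U`, and `N` lies outside the
  -- clique.
  refine hG.1 ⟨{x | (x ∈ T ∧ x ∈ C) ∨ (x ∉ T ∧ x ∉ N ∧ x ∈ B)}, ?_, ?_⟩
  · rintro x - y - (⟨hx, hxC⟩ | ⟨hx, hx', hxB⟩) (⟨hy, hyC⟩ | ⟨hy, hy', hyB⟩) hne
    · exact c1 x (mem x fun e => hc.1 (e ▸ hx)) y (mem y fun e => hc.1 (e ▸ hy)) hxC hyC hne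
    · exact hT x hx y hy hy'
    · exact (hT y hy x hx hx').symm
    · exact hcl x y hx hy hxB hyB hne
  · classical
    -- Collapsing the independent set `U \ B` to `u` preserves adjacency outside the new clique, so
    -- transitivity of non-adjacency is inherited from the complement of `C` in `G - c`.
    let φ : V → V := fun x => if x ∈ T ∨ x ∈ N then x else u
    have hφ : ∀ x, ¬ ((x ∈ T ∧ x ∈ C) ∨ (x ∉ T ∧ x ∉ N ∧ x ∈ B)) → φ x ∉ C ∧ φ x ≠ c := by
      intro x hx
      simp only [φ]
      have := hCN x
      split_ifs <;> grind
    have hφadj : ∀ x y, ¬ ((x ∈ T ∧ x ∈ C) ∨ (x ∉ T ∧ x ∉ N ∧ x ∈ B)) →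
        ¬ ((y ∈ T ∧ y ∈ C) ∨ (y ∉ T ∧ y ∉ N ∧ y ∈ B)) → (G.Adj (φ x) (φ y) ↔ G.Adj x y) := by
      intro x y hx hy
      have twin : ∀ p q, p ∈ T ∨ p ∈ N → ¬ (q ∈ T ∨ q ∈ N) → (G.Adj p u ↔ G.Adj p q) := by
        rintro p q (hp | hp) hq
        · exact iff_of_true (hT p hp u huT huN) (hT p hp q (fun h => hq (.inl h))
            (fun h => hq (.inr h)))
        · exact iff_of_false (hN p hp u huT huN) (hN p hp q (fun h => hq (.inl h))
            (fun h => hq (.inr h)))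
      simp only [φ]
      split_ifs with h1 h2 h2
      · rfl
      · exact twin x y h1 h2
      · rw [G.adj_comm, twin y x h2 h1, G.adj_comm]
      · refine iff_of_false G.irrefl (hind x y ?_ ?_ ?_ ?_ ?_ ?_) <;> grind
    intro x _ y _ z _ hx hy hz
    rw [← hφadj x y hx hy, ← hφadj y z hy hz, ← hφadj x z hx hz]
    exact c2 _ (mem _ (hφ x hx).2) _ (mem _ (hφ y hy).2) _ (mem _ (hφ z hz).2) (hφ x hx).1
      (hφ y hy).1 (hφ z hz).1

/-- `v` is adjacent to all, to none, or exactly to the inner two of `a`, `b`, `c`, `d`. -/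
def IsTame (G : SimpleGraph V) (a b c d v : V) : Prop :=
  (G.Adj v a ∧ G.Adj v b ∧ G.Adj v c ∧ G.Adj v d) ∨
  (¬ G.Adj v a ∧ ¬ G.Adj v b ∧ ¬ G.Adj v c ∧ ¬ G.Adj v d) ∨
  (¬ G.Adj v a ∧ G.Adj v b ∧ G.Adj v c ∧ ¬ G.Adj v d)

/-- No induced `P₄` through `v` meets `{a, b, c, d}`. -/
def IsClean (G : SimpleGraph V) (a b c d v : V) : Prop :=
  ∀ x y z, IsP4 G v x y z ∨ IsP4 G x v y z →
    ∀ u, u = x ∨ u = y ∨ u = z → u ≠ a ∧ u ≠ b ∧ u ≠ c ∧ u ≠ d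

theorem IsP4.reverse {a b c d : V} (h : IsP4 G a b c d) : IsP4 G d c b a := by
  obtain ⟨h1, h2, h3, h4, h5, h6⟩ := h
  exact ⟨h3.symm, h2.symm, h1.symm, fun h => h5 h.symm, fun h => h4 h.symm, fun h => h6 h.symm⟩

theorem IsClean.reverse {a b c d v : V} (h : IsClean G a b c d v) : IsClean G d c b a v := by
  intro x y z hP u hu
  have := h x y z hP u hu
  tauto

/-- Any other adjacency pattern produces an induced `P₄` from `v` and three vertices of the path. Up
to reversal, `v` is its first or second vertex. -/
theorem isTame_of_forall_not_isP4 {a b c d v : V} (hP : IsP4 G a b c d)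
    (h : ∀ x y z, (x = a ∨ x = b ∨ x = c ∨ x = d) → (y = a ∨ y = b ∨ y = c ∨ y = d) →
      (z = a ∨ z = b ∨ z = c ∨ z = d) → ¬ IsP4 G v x y z ∧ ¬ IsP4 G x v y z) :
    IsTame G a b c d v := by
  obtain ⟨hab, hbc, hcd, hac, hbd, had⟩ := hP
  have mk1 : ∀ x y z, (x = a ∨ x = b ∨ x = c ∨ x = d) → (y = a ∨ y = b ∨ y = c ∨ y = d) →
      (z = a ∨ z = b ∨ z = c ∨ z = d) → G.Adj v x → G.Adj x y → G.Adj y z → ¬ G.Adj v y →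
      ¬ G.Adj x z → ¬ G.Adj v z → False :=
    fun x y z hx hy hz h1 h2 h3 h4 h5 h6 => (h x y z hx hy hz).1 ⟨h1, h2, h3, h4, h5, h6⟩
  have mk2 : ∀ x y z, (x = a ∨ x = b ∨ x = c ∨ x = d) → (y = a ∨ y = b ∨ y = c ∨ y = d) →
      (z = a ∨ z = b ∨ z = c ∨ z = d) → G.Adj v x → G.Adj v y → G.Adj y z → ¬ G.Adj x y →
      ¬ G.Adj v z → ¬ G.Adj x z → False :=
    fun x y z hx hy hz h1 h2 h3 h4 h5 h6 =>
      (h x y z hx hy hz).2 ⟨h1.symm, h2, h3, h4, h5, h6⟩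
  have e1 := mk1 b c d (by simp) (by simp) (by simp)
  have e2 := mk1 c b a (by simp) (by simp) (by simp)
  have e3 := mk1 a b c (by simp) (by simp) (by simp)
  have e4 := mk1 d c b (by simp) (by simp) (by simp)
  have f1 := mk2 a c d (by simp) (by simp) (by simp)
  have f2 := mk2 d b a (by simp) (by simp) (by simp)
  have f3 := mk2 a d c (by simp) (by simp) (by simp)
  have f4 := mk2 d a b (by simp) (by simp) (by simp)
  clear h mk1 mk2
  unfold IsTame
  by_cases h1 : G.Adj v a <;> by_cases h2 : G.Adj v b <;> by_cases h3 : G.Adj v c <;>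
    by_cases h4 : G.Adj v d <;> grind [SimpleGraph.adj_comm]

/-- If only `T` is nonempty, `G` is a join; if only `N` is, `G` is disconnected; both together are
excluded by `Obstruction.not_homogeneous`. -/
theorem Obstruction.eq_empty_of_homogeneous [Finite V] (hG : Obstruction G)
    (hE : EssentialFree G) {T N : Set V} (hTN : ∀ x ∈ T, x ∉ N)
    (hT : ∀ x ∈ T, ∀ u, u ∉ T → u ∉ N → G.Adj x u)
    (hN : ∀ x ∈ N, ∀ u, u ∉ T → u ∉ N → ¬ G.Adj x u)
    {a b c d : V} (hP : IsP4 G a b c d) (ha : a ∉ T ∧ a ∉ N) (hb : b ∉ T ∧ b ∉ N)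
    (hc : c ∉ T ∧ c ∉ N) (hd : d ∉ T ∧ d ∉ N) (x : V) : x ∉ T ∧ x ∉ N := by
  by_cases hT' : ∃ t, t ∈ T
  · obtain ⟨t, ht⟩ := hT'
    by_cases hN' : ∃ n, n ∈ N
    · obtain ⟨n, hn⟩ := hN'
      exact (hG.not_homogeneous hTN ht hn hT hN hP ha hb hc hd).elim
    · push Not at hN'
      refine (hG.not_separates_compl T ⟨⟨t, trivial, ht⟩, ⟨a, trivial, ha.1⟩, ?_⟩).elim
      intro x _ y _ hx hy
      simp [compl_adj, hT x hx y hy (hN' y)]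
  · push Not at hT'
    refine ⟨hT' x, fun hx => ?_⟩
    refine hG.not_separates hE N ⟨⟨x, trivial, hx⟩, ⟨a, trivial, ha.2⟩, ?_⟩
    intro x _ y _ hx hy
    exact hN x hx y (hT' y) hy

/-! ### Polar partitions around a path and its extension vertex -/

/-- In a minimal obstruction an induced `P₄`, extended by at most one vertex `e`, sees all other
vertices only through its two inner vertices. -/
theorem Obstruction.adj_inner [Finite V] (hG : Obstruction G) (hE : EssentialFree G)
    {a b c d e : V} (hP : IsP4 G a b c d)
    (htame : ∀ v, v ≠ a → v ≠ b → v ≠ c → v ≠ d → v ≠ e → IsTame G a b c d v)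
    (hTe : ∀ v, v ≠ a → v ≠ b → v ≠ c → v ≠ d → v ≠ e →
      G.Adj v a → G.Adj v b → G.Adj v c → G.Adj v d → G.Adj v e)
    (hNe : ∀ v, v ≠ a → v ≠ b → v ≠ c → v ≠ d → v ≠ e →
      ¬ G.Adj v a → ¬ G.Adj v b → ¬ G.Adj v c → ¬ G.Adj v d → ¬ G.Adj v e)
    (hTM : ∀ v w, v ≠ a → v ≠ b → v ≠ c → v ≠ d → v ≠ e →
      w ≠ a → w ≠ b → w ≠ c → w ≠ d → w ≠ e → ¬ IsP4 G v b w d)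
    (hNM : ∀ v w, v ≠ a → v ≠ b → v ≠ c → v ≠ d → v ≠ e →
      w ≠ a → w ≠ b → w ≠ c → w ≠ d → w ≠ e → ¬ IsP4 G v w b a)
    (v : V) (ha : v ≠ a) (hb : v ≠ b) (hc : v ≠ c) (hd : v ≠ d) (he : v ≠ e) :
    ¬ G.Adj v a ∧ G.Adj v b ∧ G.Adj v c ∧ ¬ G.Adj v d := by
  have := hG.eq_empty_of_homogeneous hE
    (T := {v | v ≠ e ∧ G.Adj v a ∧ G.Adj v b ∧ G.Adj v c ∧ G.Adj v d})
    (N := {v | (v ≠ a ∧ v ≠ b ∧ v ≠ c ∧ v ≠ d ∧ v ≠ e) ∧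
      ¬ G.Adj v a ∧ ¬ G.Adj v b ∧ ¬ G.Adj v c ∧ ¬ G.Adj v d})
    (fun x hx hx' => hx'.2.1 hx.2.1) ?_ ?_ hP ?_ ?_ ?_ ?_ v
  · have := htame v ha hb hc hd he
    unfold IsTame at this
    simp only [Set.mem_ofPred_eq] at *
    tauto
  · rintro x ⟨hxe, hxa, hxb, hxc, hxd⟩ u huT huN
    by_contra hxu
    have hu : u ≠ a ∧ u ≠ b ∧ u ≠ c ∧ u ≠ d := by grind
    have hue : u ≠ e := fun h => hxu (h ▸ hTe x hxa.ne hxb.ne hxc.ne hxd.ne hxe hxa hxb hxc hxd)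
    have := htame u hu.1 hu.2.1 hu.2.2.1 hu.2.2.2 hue
    unfold IsTame at this
    simp only [Set.mem_ofPred_eq] at *
    -- Here `u` sees exactly `b` and `c`, so a missing edge `x u` creates the path `u b x d`.
    -- Dually, an edge from `N` to `u` creates `x u b a`.
    refine hTM u x hu.1 hu.2.1 hu.2.2.1 hu.2.2.2 hue hxa.ne hxb.ne hxc.ne hxd.ne hxe
      ⟨?_, hxb.symm, hxd, fun h => hxu h.symm, hP.bd, ?_⟩ <;> tauto
  · rintro x ⟨⟨ha, hb, hc, hd, he⟩, hxa, hxb, hxc, hxd⟩ u huT huN hxu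
    have hu : u ≠ a ∧ u ≠ b ∧ u ≠ c ∧ u ≠ d := by grind
    have hue : u ≠ e := fun h => hNe x ha hb hc hd he hxa hxb hxc hxd (h ▸ hxu)
    have := htame u hu.1 hu.2.1 hu.2.2.1 hu.2.2.2 hue
    unfold IsTame at this
    simp only [Set.mem_ofPred_eq] at *
    refine hNM x u ha hb hc hd he hu.1 hu.2.1 hu.2.2.1 hu.2.2.2 hue
      ⟨hxu, ?_, hP.ab.symm, hxb, ?_, hxa⟩ <;> tauto
  all_goals
    obtain ⟨h1, h2, h3, h4, h5, h6⟩ := hP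
    simp only [Set.mem_ofPred_eq]
    grind [SimpleGraph.adj_comm, SimpleGraph.irrefl]

/-- The vertices that see only the inner vertices of a `P₄` induce a split graph. -/
theorem Obstruction.exists_split (hG : Obstruction G) {a b d : V} (had : ¬ G.Adj a d)
    (hne : a ≠ d) (hba : b ≠ a) (hbd : b ≠ d) (M : Set V) (hbM : b ∉ M)
    (hM : ∀ x ∈ M, x ≠ a ∧ x ≠ d ∧ ¬ G.Adj x a ∧ ¬ G.Adj x d) :
    ∃ B : Set V, (∀ x ∈ M, ∀ y ∈ M, x ∈ B → y ∈ B → x ≠ y → G.Adj x y) ∧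
      ∀ x ∈ M, ∀ y ∈ M, x ∉ B → y ∉ B → ¬ G.Adj x y := by
  obtain ⟨B, b1, b2⟩ := hG.2 {b}ᶜ (fun h => (h ▸ Set.mem_univ b : b ∈ ({b}ᶜ : Set V)) rfl)
  have mem : ∀ x, x ≠ b → x ∈ ({b}ᶜ : Set V) := fun x hx => hx
  have memM : ∀ x ∈ M, x ∈ ({b}ᶜ : Set V) := fun x hx e => hbM (e ▸ hx)
  refine ⟨B, fun x hx y hy => b1 x (memM x hx) y (memM y hy), ?_⟩
  intro x hx y hy hxB hyB
  obtain ⟨-, -, hxa, hxd⟩ := hM x hx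
  obtain ⟨-, -, hya, hyd⟩ := hM y hy
  -- The non-adjacent `a` and `d` are not both in the clique; whichever lies outside is a common
  -- non-neighbour of `M`, so `M \ B` is independent.
  by_cases haB : a ∈ B
  · by_cases hdB : d ∈ B
    · exact absurd (b1 a (mem a hba.symm) d (mem d hbd.symm) haB hdB hne) had
    · exact b2 x (memM x hx) d (mem d hbd.symm) y (memM y hy) hxB hdB hyB hxd
        (fun h => hyd h.symm)
  · exact b2 x (memM x hx) a (mem a hba.symm) y (memM y hy) hxB haB hyB hxa
      (fun h => hya h.symm)

theorem Obstruction.not_split (hG : Obstruction G) (B : Set V)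
    (h1 : ∀ x ∈ B, ∀ y ∈ B, x ≠ y → G.Adj x y) (h2 : ∀ x ∉ B, ∀ y ∉ B, ¬ G.Adj x y) : False :=
  hG.1 ⟨B, fun x _ y _ hx hy => h1 x hx y hy, fun x _ _ _ z _ hx _ hz _ _ => h2 x hx z hz⟩

/-- `v` is adjacent exactly to the inner two of `a`, `b`, `c`, `d`. -/
def IsInner (G : SimpleGraph V) (a b c d v : V) : Prop :=
  ¬ G.Adj v a ∧ G.Adj v b ∧ G.Adj v c ∧ ¬ G.Adj v d

/-- `v` is none of `a`, `b`, `c`, `d`, `e`. -/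
def IsOutside (a b c d e v : V) : Prop := v ≠ a ∧ v ≠ b ∧ v ≠ c ∧ v ≠ d ∧ v ≠ e

theorem IsOutside.cases (a b c d e x : V) :
    x = a ∨ x = b ∨ x = c ∨ x = d ∨ x = e ∨ IsOutside a b c d e x := by
  unfold IsOutside
  tauto

theorem Obstruction.exists_split_outside {a b c d e : V} (hG : Obstruction G)
    (hP : IsP4 G a b c d) (hM : ∀ v, IsOutside a b c d e v → IsInner G a b c d v) :
    ∃ B : Set V, (∀ x ∈ {x | IsOutside a b c d e x}, ∀ y ∈ {x | IsOutside a b c d e x},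
      x ∈ B → y ∈ B → x ≠ y → G.Adj x y) ∧
      ∀ x ∈ {x | IsOutside a b c d e x}, ∀ y ∈ {x | IsOutside a b c d e x},
        x ∉ B → y ∉ B → ¬ G.Adj x y :=
  hG.exists_split (b := b) hP.ad (fun h => hP.ac (h ▸ hP.cd.symm)) hP.ab.ne'
    (fun h => hP.ad (h ▸ hP.ab)) {x | IsOutside a b c d e x} (fun h => h.2.1 rfl)
    (fun x hx => ⟨hx.1, hx.2.2.2.1, (hM x hx).1, (hM x hx).2.2.2⟩)

/-- Here `e` behaves like an end of the path: `b`, `c` and the clique part of the split graph form a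
clique, and all else is independent. -/
theorem Obstruction.false_of_outer {a b c d e : V} (hG : Obstruction G)
    (hP : IsP4 G a b c d) (hM : ∀ v, IsOutside a b c d e v → IsInner G a b c d v)
    (hea : ¬ G.Adj e a) (hed : ¬ G.Adj e d)
    (hMe : ∀ v, IsOutside a b c d e v → ¬ G.Adj v e) (hee : e ≠ b) (hec : e ≠ c) : False := by
  obtain ⟨K, k1, k2⟩ := hG.exists_split_outside hP hM
  obtain ⟨hab, hbc, hcd, hac, hbd, had⟩ := hP
  refine hG.not_split {x | x = b ∨ x = c ∨ (IsOutside a b c d e x ∧ x ∈ K)} ?_ ?_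
  · rintro x (rfl | rfl | ⟨hx, hxK⟩) y (rfl | rfl | ⟨hy, hyK⟩) hne
    · exact absurd rfl hne
    · exact hbc
    · exact (hM y hy).2.1.symm
    · exact hbc.symm
    · exact absurd rfl hne
    · exact (hM y hy).2.2.1.symm
    · exact (hM x hx).2.1
    · exact (hM x hx).2.2.1
    · exact k1 x hx y hy hxK hyK hne
  · have key : ∀ x, x ∉ {x | x = b ∨ x = c ∨ (IsOutside a b c d e x ∧ x ∈ K)} →
        x = a ∨ x = d ∨ x = e ∨ (IsOutside a b c d e x ∧ x ∉ K) := by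
      intro x hx
      have := IsOutside.cases a b c d e x
      simp only [Set.mem_ofPred_eq] at hx
      tauto
    intro x hx y hy
    rcases key x hx with rfl | rfl | rfl | ⟨hx, hxK⟩ <;>
      rcases key y hy with rfl | rfl | rfl | ⟨hy, hyK⟩ <;>
      first
      | exact G.irrefl
      | assumption
      | (intro h; have := h.symm; contradiction)
      | exact (hM _ hx).1
      | exact (hM _ hx).2.2.2
      | exact hMe _ hx
      | exact fun h => (hM _ hy).1 h.symm
      | exact fun h => (hM _ hy).2.2.2 h.symm
      | exact fun h => hMe _ hy h.symm
      | exact k2 x hx y hy hxK hyK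

/-- Here `e` behaves like an inner vertex of the path and joins the clique. -/
theorem Obstruction.false_of_inner {a b c d e : V} (hG : Obstruction G)
    (hP : IsP4 G a b c d) (hM : ∀ v, IsOutside a b c d e v → IsInner G a b c d v)
    (heb : G.Adj e b) (hec : G.Adj e c)
    (hMe : ∀ v, IsOutside a b c d e v → G.Adj v e) : False := by
  obtain ⟨K, k1, k2⟩ := hG.exists_split_outside hP hM
  obtain ⟨hab, hbc, hcd, hac, hbd, had⟩ := hP
  refine hG.not_split {x | x = b ∨ x = c ∨ x = e ∨ (IsOutside a b c d e x ∧ x ∈ K)} ?_ ?_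
  · rintro x (rfl | rfl | rfl | ⟨hx, hxK⟩) y (rfl | rfl | rfl | ⟨hy, hyK⟩) hne <;>
      first
      | exact absurd rfl hne
      | assumption
      | (apply SimpleGraph.Adj.symm; assumption)
      | exact (hM _ hx).2.1
      | exact (hM _ hx).2.2.1
      | exact hMe _ hx
      | exact (hM _ hy).2.1.symm
      | exact (hM _ hy).2.2.1.symm
      | exact (hMe _ hy).symm
      | exact k1 x hx y hy hxK hyK hne
  · have key : ∀ x, x ∉ {x | x = b ∨ x = c ∨ x = e ∨ (IsOutside a b c d e x ∧ x ∈ K)} →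
        x = a ∨ x = d ∨ (IsOutside a b c d e x ∧ x ∉ K) := by
      intro x hx
      have := IsOutside.cases a b c d e x
      simp only [Set.mem_ofPred_eq] at hx
      tauto
    intro x hx y hy
    rcases key x hx with rfl | rfl | ⟨hx, hxK⟩ <;>
      rcases key y hy with rfl | rfl | ⟨hy, hyK⟩ <;>
      first
      | exact G.irrefl
      | assumption
      | (intro h; have := h.symm; contradiction)
      | exact (hM _ hx).1
      | exact (hM _ hx).2.2.2
      | exact fun h => (hM _ hy).1 h.symm
      | exact fun h => (hM _ hy).2.2.2 h.symm
      | exact k2 x hx y hy hxK hyK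

/-- The extension of the `P₄` by a true twin of its end vertex. -/
theorem Obstruction.false_of_true_twin {a b c d e : V} (hG : Obstruction G)
    (hP : IsP4 G a b c d) (hM : ∀ v, IsOutside a b c d e v → IsInner G a b c d v)
    (hE : EssentialFree G) (hea : G.Adj e a) (heb : G.Adj e b)
    (hed : ¬ G.Adj e d)
    (hMe : ∀ v, IsOutside a b c d e v → ¬ G.Adj v e) : False := by
  obtain ⟨hab, hbc, hcd, hac, hbd, had⟩ := hP
  have hind : ∀ x y, IsOutside a b c d e x → IsOutside a b c d e y → ¬ G.Adj x y := by
    intro x y hx hy hxy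
    exact hE.k1_2k2 d a e x y hea.symm hxy (fun h => (hM x hx).1 h.symm)
      (fun h => (hM y hy).1 h.symm) (fun h => hMe x hx h.symm) (fun h => hMe y hy h.symm)
      (fun h => had h.symm) (fun h => hed h.symm) (fun h => (hM x hx).2.2.2 h.symm)
      (fun h => (hM y hy).2.2.2 h.symm)
  -- Outside the triangle `a b e` remains a star with centre `c`.
  refine hG.1 ⟨{x | x = a ∨ x = b ∨ x = e}, ?_, ?_⟩
  · rintro x - y - (rfl | rfl | rfl) (rfl | rfl | rfl) hne <;>
      first
      | exact absurd rfl hne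
      | assumption
      | (apply SimpleGraph.Adj.symm; assumption)
  · have key : ∀ x, x ∉ {x | x = a ∨ x = b ∨ x = e} →
        x = c ∨ (G.Adj x c ∧ (x = d ∨ IsOutside a b c d e x)) := by
      intro x hx
      have := IsOutside.cases a b c d e x
      simp only [Set.mem_ofPred_eq] at hx
      have := hM x
      unfold IsInner at this
      have := hcd.symm
      grind
    have star : ∀ x y, (x = d ∨ IsOutside a b c d e x) → (y = d ∨ IsOutside a b c d e y) →
        ¬ G.Adj x y := by
      rintro x y (rfl | hx) (rfl | hy)
      · exact G.irrefl
      · exact fun h => (hM y hy).2.2.2 h.symm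
      · exact (hM x hx).2.2.2
      · exact hind x y hx hy
    intro x _ y _ z _ hx hy hz hxy hyz
    rcases key x hx with rfl | ⟨hxc, hx'⟩ <;> rcases key y hy with rfl | ⟨hyc, hy'⟩ <;>
      rcases key z hz with rfl | ⟨hzc, hz'⟩ <;>
      first
      | exact G.irrefl
      | exact star x z hx' hz'
      | exact absurd hyc.symm hxy
      | exact absurd hyc hyz
      | exact absurd hzc.symm hyz
      | exact absurd hxc hxy

/-- The extension of the `P₄` by a false twin of its inner vertex. -/
theorem Obstruction.false_of_false_twin {a b c d e : V} (hG : Obstruction G)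
    (hP : IsP4 G a b c d) (hM : ∀ v, IsOutside a b c d e v → IsInner G a b c d v)
    (hE : EssentialFree G) (hea : G.Adj e a)
    (heb : ¬ G.Adj e b) (hec : G.Adj e c) (hed : ¬ G.Adj e d) (hne : e ≠ b)
    (hMe : ∀ v, IsOutside a b c d e v → G.Adj v e) : False := by
  obtain ⟨hab, hbc, hcd, hac, hbd, had⟩ := hP
  have hind : ∀ x y, IsOutside a b c d e x → IsOutside a b c d e y → ¬ G.Adj x y := by
    intro x y hx hy hxy
    exact hE.k1_compl_p3_k2 d x a y b e (hM x hx).1 (fun h => (hM y hy).1 h.symm) hxy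
      hx.1 hy.1.symm (fun h => heb h.symm) hne.symm (hM x hx).2.1 (hMe x hx) hab hea.symm
      (hM y hy).2.1 (hMe y hy) (fun h => (hM x hx).2.2.2 h.symm) (fun h => had h.symm)
      (fun h => (hM y hy).2.2.2 h.symm) (fun h => hbd h.symm) (fun h => hed h.symm)
  -- Outside the edge `c d` remains a complete bipartite graph: `b`, `e` against `a` and the outside
  -- vertices.
  refine hG.1 ⟨{x | x = c ∨ x = d}, ?_, ?_⟩
  · rintro x - y - (rfl | rfl) (rfl | rfl) hne <;>
      first
      | exact absurd rfl hne
      | assumption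
      | (apply SimpleGraph.Adj.symm; assumption)
  · have key : ∀ x, x ∉ {x | x = c ∨ x = d} →
        (x = b ∨ x = e) ∨ (x = a ∨ IsOutside a b c d e x) := by
      intro x hx
      have := IsOutside.cases a b c d e x
      simp only [Set.mem_ofPred_eq] at hx
      tauto
    have p1 : ∀ x y, (x = b ∨ x = e) → (y = b ∨ y = e) → ¬ G.Adj x y := by
      rintro x y (rfl | rfl) (rfl | rfl)
      · exact G.irrefl
      · exact fun h => heb h.symm
      · exact heb
      · exact G.irrefl
    have p2 : ∀ x y, (x = a ∨ IsOutside a b c d e x) → (y = a ∨ IsOutside a b c d e y) →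
        ¬ G.Adj x y := by
      rintro x y (rfl | hx) (rfl | hy)
      · exact G.irrefl
      · exact fun h => (hM y hy).1 h.symm
      · exact (hM x hx).1
      · exact hind x y hx hy
    have p3 : ∀ x y, (x = b ∨ x = e) → (y = a ∨ IsOutside a b c d e y) → G.Adj x y := by
      rintro x y (rfl | rfl) (rfl | hy)
      · exact hab.symm
      · exact (hM y hy).2.1.symm
      · exact hea
      · exact (hMe y hy).symm
    intro x _ y _ z _ hx hy hz hxy hyz
    rcases key x hx with hx | hx <;> rcases key y hy with hy | hy <;>
      rcases key z hz with hz | hz <;>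
      first
      | exact p1 x z hx hz
      | exact p2 x z hx hz
      | exact absurd (p3 x y hx hy) hxy
      | exact absurd (p3 y x hy hx).symm hxy
      | exact absurd (p3 y z hy hz) hyz
      | exact absurd (p3 z y hz hy).symm hyz

/-- Five vertices partitioned into an edge and an induced `P₃`. -/
theorem Obstruction.false_of_five (hG : Obstruction G) {p q r s t : V} (hpq : G.Adj p q)
    (hrs : G.Adj r s) (hst : G.Adj s t) (hrt : ¬ G.Adj r t)
    (hall : ∀ x, x = p ∨ x = q ∨ x = r ∨ x = s ∨ x = t) : False := by
  refine hG.1 ⟨{x | x = p ∨ x = q}, ?_, ?_⟩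
  · rintro x - y - (rfl | rfl) (rfl | rfl) hne
    · exact absurd rfl hne
    · exact hpq
    · exact hpq.symm
    · exact absurd rfl hne
  · intro x _ y _ z _ hx hy hz
    have hx' := hall x
    have hy' := hall y
    have hz' := hall z
    simp only [Set.mem_ofPred_eq] at hx hy hz
    grind [SimpleGraph.adj_comm, SimpleGraph.irrefl]

/-! ### Extendibility and the conclusion -/

/-- A forbidden `P₄` through `v` would contain an edge `y z` inside `{a, b, c, d, e}`. Its ends
cannot both be `e`, so it meets the original path. Hence a clean vertex is tame for every `P₄` that
uses `e` as well. -/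
theorem isTame_of_isClean {a b c d e v p q r s : V} (hv : IsClean G a b c d v)
    (hP : IsP4 G p q r s) (hp : p = a ∨ p = b ∨ p = c ∨ p = d ∨ p = e)
    (hq : q = a ∨ q = b ∨ q = c ∨ q = d ∨ q = e) (hr : r = a ∨ r = b ∨ r = c ∨ r = d ∨ r = e)
    (hs : s = a ∨ s = b ∨ s = c ∨ s = d ∨ s = e) : IsTame G p q r s v := by
  have split : ∀ x, x = a ∨ x = b ∨ x = c ∨ x = d ∨ x = e →
      (x = a ∨ x = b ∨ x = c ∨ x = d) ∨ x = e := by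
    rintro x (h | h | h | h | h) <;> simp [h]
  have mem : ∀ x, x = p ∨ x = q ∨ x = r ∨ x = s → (x = a ∨ x = b ∨ x = c ∨ x = d) ∨ x = e := by
    rintro x (rfl | rfl | rfl | rfl)
    exacts [split _ hp, split _ hq, split _ hr, split _ hs]
  refine isTame_of_forall_not_isP4 hP fun x y z _ hy hz => ?_
  have key : (IsP4 G v x y z ∨ IsP4 G x v y z) → False := by
    intro h
    have hyz : G.Adj y z := h.elim IsP4.cd IsP4.cd
    have avoid : ∀ u, u = x ∨ u = y ∨ u = z → ¬ (u = a ∨ u = b ∨ u = c ∨ u = d) := by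
      intro u hu
      obtain ⟨h1, h2, h3, h4⟩ := hv x y z h u hu
      simp [h1, h2, h3, h4]
    have hye := (mem y hy).resolve_left (avoid y (by simp))
    have hze := (mem z hz).resolve_left (avoid z (by simp))
    exact hyz.ne (hye.trans hze.symm)
  exact ⟨fun h => key (.inl h), fun h => key (.inr h)⟩

/-- The seven ways, up to reversal, in which `e` and three vertices of the path `a`, `b`, `c`, `d`
form an induced `P₄`. -/
def IsExtension (G : SimpleGraph V) (a b c d e : V) : Prop :=
  (G.Adj e a ∧ ¬ G.Adj e b ∧ ¬ G.Adj e c ∧ ¬ G.Adj e d) ∨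
  (¬ G.Adj e a ∧ G.Adj e b ∧ ¬ G.Adj e c ∧ ¬ G.Adj e d) ∨
  (G.Adj e a ∧ G.Adj e b ∧ ¬ G.Adj e c ∧ ¬ G.Adj e d) ∨
  (G.Adj e a ∧ ¬ G.Adj e b ∧ G.Adj e c ∧ ¬ G.Adj e d) ∨
  (G.Adj e a ∧ ¬ G.Adj e b ∧ ¬ G.Adj e c ∧ G.Adj e d) ∨
  (G.Adj e a ∧ G.Adj e b ∧ G.Adj e c ∧ ¬ G.Adj e d) ∨
  (G.Adj e a ∧ G.Adj e b ∧ ¬ G.Adj e c ∧ G.Adj e d)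

theorem isExtension_of_not_isTame {a b c d e : V} (h : ¬ IsTame G a b c d e) :
    IsExtension G a b c d e ∨ IsExtension G d c b a e := by
  unfold IsTame at h
  unfold IsExtension
  by_cases h1 : G.Adj e a <;> by_cases h2 : G.Adj e b <;> by_cases h3 : G.Adj e c <;>
    by_cases h4 : G.Adj e d <;> simp_all

theorem Obstruction.false_of_isExtension [Finite V] (hG : Obstruction G) (hE : EssentialFree G)
    {a b c d e : V} (hP : IsP4 G a b c d) (heb : e ≠ b) (hec : e ≠ c)
    (hclean : ∀ v, IsOutside a b c d e v → IsClean G a b c d v)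
    (hext : IsExtension G a b c d e) : False := by
  have htame : ∀ v, IsOutside a b c d e v → ∀ p q r s, IsP4 G p q r s →
      (p = a ∨ p = b ∨ p = c ∨ p = d ∨ p = e) → (q = a ∨ q = b ∨ q = c ∨ q = d ∨ q = e) →
      (r = a ∨ r = b ∨ r = c ∨ r = d ∨ r = e) → (s = a ∨ s = b ∨ s = c ∨ s = d ∨ s = e) →
      IsTame G p q r s v :=
    fun v hv p q r s h hp hq hr hs => isTame_of_isClean (hclean v hv) h hp hq hr hs
  have mid : (∀ v, IsOutside a b c d e v → G.Adj v a → G.Adj v b → G.Adj v c → G.Adj v d →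
      G.Adj v e) → (∀ v, IsOutside a b c d e v → ¬ G.Adj v a → ¬ G.Adj v b → ¬ G.Adj v c →
      ¬ G.Adj v d → ¬ G.Adj v e) → ∀ v, IsOutside a b c d e v → IsInner G a b c d v := by
    intro h1 h2 v hv
    refine hG.adj_inner hE hP (e := e) ?_ ?_ ?_ ?_ ?_ v hv.1 hv.2.1 hv.2.2.1 hv.2.2.2.1 hv.2.2.2.2
    · exact fun v a1 a2 a3 a4 a5 => htame v ⟨a1, a2, a3, a4, a5⟩ a b c d hP (by simp) (by simp)
        (by simp) (by simp)
    · exact fun v a1 a2 a3 a4 a5 => h1 v ⟨a1, a2, a3, a4, a5⟩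
    · exact fun v a1 a2 a3 a4 a5 => h2 v ⟨a1, a2, a3, a4, a5⟩
    · intro v w a1 a2 a3 a4 a5 _ _ _ _ _ h
      exact (hclean v ⟨a1, a2, a3, a4, a5⟩ _ _ _ (.inl h) b (by simp)).2.1 rfl
    · intro v w a1 a2 a3 a4 a5 _ _ _ _ _ h
      exact (hclean v ⟨a1, a2, a3, a4, a5⟩ _ _ _ (.inl h) b (by simp)).2.1 rfl
  have hP' := hP
  obtain ⟨hab, hbc, hcd, hac, hbd, had⟩ := hP'
  have five : (∀ v, ¬ IsOutside a b c d e v) →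
      ∀ x, x = a ∨ x = b ∨ x = c ∨ x = d ∨ x = e := by
    intro h x
    have := IsOutside.cases a b c d e x
    have := h x
    tauto
  rcases hext with ⟨h1, h2, h3, h4⟩ | ⟨h1, h2, h3, h4⟩ | ⟨h1, h2, h3, h4⟩ | ⟨h1, h2, h3, h4⟩ |
    ⟨h1, h2, h3, h4⟩ | ⟨h1, h2, h3, h4⟩ | ⟨h1, h2, h3, h4⟩
  -- Each case applies tameness to a second `P₄`, one through `e`, to fix how outside vertices
  -- attach to `e`. Here the five vertices induce a `P₅`, and the two conditions on an outside
  -- vertex contradict each other, so there is none.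
  · have t : ∀ v, IsOutside a b c d e v → IsTame G e a b c v := fun v hv =>
      htame v hv e a b c ⟨h1, hab, hbc, h2, hac, h3⟩ (by simp) (by simp) (by simp) (by simp)
    have hM := mid (by unfold IsTame at t; grind) (by unfold IsTame at t; grind)
    have := five fun v hv => by
      have := hM v hv; have := t v hv; unfold IsTame IsInner at *; tauto
    exact hG.false_of_five h1 hbc hcd hbd (fun x => by have := this x; tauto)
  · have t : ∀ v, IsOutside a b c d e v → IsTame G e b c d v := fun v hv =>
      htame v hv e b c d ⟨h2, hbc, hcd, h3, hbd, h4⟩ (by simp) (by simp) (by simp) (by simp)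
    have hM := mid (by unfold IsTame at t; grind) (by unfold IsTame at t; grind)
    exact hG.false_of_outer hP hM h1 h4 (fun v hv => by
      have := hM v hv; have := t v hv; unfold IsTame IsInner at *; tauto) heb hec
  · have t : ∀ v, IsOutside a b c d e v → IsTame G e b c d v := fun v hv =>
      htame v hv e b c d ⟨h2, hbc, hcd, h3, hbd, h4⟩ (by simp) (by simp) (by simp) (by simp)
    have hM := mid (by unfold IsTame at t; grind) (by unfold IsTame at t; grind)
    exact hG.false_of_true_twin hP hM hE h1 h2 h4 (fun v hv => by
      have := hM v hv; have := t v hv; unfold IsTame IsInner at *; tauto)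
  · have t : ∀ v, IsOutside a b c d e v → IsTame G a e c d v := fun v hv =>
      htame v hv a e c d ⟨h1.symm, h3, hcd, hac, h4, had⟩ (by simp) (by simp) (by simp) (by simp)
    have hM := mid (by unfold IsTame at t; grind) (by unfold IsTame at t; grind)
    exact hG.false_of_false_twin hP hM hE h1 h2 h3 h4 heb (fun v hv => by
      have := hM v hv; have := t v hv; unfold IsTame IsInner at *; tauto)
  -- The five vertices induce a `C₅`; again no outside vertex is possible.
  · have t : ∀ v, IsOutside a b c d e v → IsTame G e a b c v := fun v hv =>
      htame v hv e a b c ⟨h1, hab, hbc, h2, hac, h3⟩ (by simp) (by simp) (by simp) (by simp)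
    have hM := mid (by unfold IsTame at t; grind) (by unfold IsTame at t; grind)
    have := five fun v hv => by
      have := hM v hv; have := t v hv; unfold IsTame IsInner at *; tauto
    exact hG.false_of_five hab hcd h4.symm (fun h => h3 h.symm) (fun x => by have := this x; tauto)
  · have t : ∀ v, IsOutside a b c d e v → IsTame G a e c d v := fun v hv =>
      htame v hv a e c d ⟨h1.symm, h3, hcd, hac, h4, had⟩ (by simp) (by simp) (by simp) (by simp)
    have hM := mid (by unfold IsTame at t; grind) (by unfold IsTame at t; grind)
    exact hG.false_of_inner hP hM h2 h3 (fun v hv => by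
      have := hM v hv; have := t v hv; unfold IsTame IsInner at *; tauto)
  -- The five vertices induce the complement of `P₅`, again without outside vertices.
  · have t : ∀ v, IsOutside a b c d e v → IsTame G c d e a v := fun v hv =>
      htame v hv c d e a ⟨hcd, h4.symm, h1, fun h => h3 h.symm, fun h => had h.symm,
        fun h => hac h.symm⟩ (by simp) (by simp) (by simp) (by simp)
    have hM := mid (by unfold IsTame at t; grind) (by unfold IsTame at t; grind)
    have := five fun v hv => by
      have := hM v hv; have := t v hv; unfold IsTame IsInner at *; tauto
    exact hG.false_of_five hab hcd h4.symm (fun h => h3 h.symm) (fun x => by have := this x; tauto)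

/-- In a `P₄`-extendible graph at most one vertex outside an induced `P₄` is not clean. -/
theorem IsP4Extendible.eq_of_not_isClean (hX : IsP4Extendible G) {a b c d v w : V}
    (hP : IsP4 G a b c d) (hv : v ≠ a ∧ v ≠ b ∧ v ≠ c ∧ v ≠ d)
    (hw : w ≠ a ∧ w ≠ b ∧ w ≠ c ∧ w ≠ d)
    (hv' : ¬ IsClean G a b c d v) (hw' : ¬ IsClean G a b c d w) : v = w := by
  have mem : ∀ v, v ≠ a ∧ v ≠ b ∧ v ≠ c ∧ v ≠ d → ¬ IsClean G a b c d v →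
      v ∈ {v : V | v ∉ ({a, b, c, d} : Set V) ∧ ∃ W' : Set V, InducesP4 G W' ∧ v ∈ W' ∧
        (W' ∩ {a, b, c, d}).Nonempty} := by
    intro v hv hv'
    unfold IsClean at hv'
    push Not at hv'
    obtain ⟨x, y, z, h, u, hu, hu'⟩ := hv'
    refine ⟨by simpa using hv, ?_⟩
    have huW : u ∈ ({a, b, c, d} : Set V) := by
      simp only [Set.mem_insert_iff, Set.mem_singleton_iff]
      tauto
    rcases h with h | h
    · refine ⟨_, h.inducesP4, by simp, u, ?_, huW⟩
      simp only [Set.mem_insert_iff, Set.mem_singleton_iff]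
      tauto
    · refine ⟨_, h.inducesP4, by simp, u, ?_, huW⟩
      simp only [Set.mem_insert_iff, Set.mem_singleton_iff]
      tauto
  exact hX _ hP.inducesP4 (mem v hv hv') (mem w hw hw')

theorem isTame_of_isClean' {a b c d v : V} (hP : IsP4 G a b c d) (hv : IsClean G a b c d v) :
    IsTame G a b c d v :=
  isTame_of_isClean (e := a) hv hP (by simp) (by simp) (by simp) (by simp)

/-- A `P₄`-extendible minimal obstruction that contains a `P₄` is essential. -/
theorem Obstruction.not_isP4 [Finite V] (hG : Obstruction G) (hE : EssentialFree G)
    (hX : IsP4Extendible G) (a b c d : V) : ¬ IsP4 G a b c d := by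
  intro hP
  by_cases hbad : ∃ e, (e ≠ a ∧ e ≠ b ∧ e ≠ c ∧ e ≠ d) ∧ ¬ IsTame G a b c d e
  · obtain ⟨e, he, hbad⟩ := hbad
    -- A vertex that is not tame is not clean, so `e` uses up the single exception that
    -- extendibility allows.
    have hclean : ∀ v, IsOutside a b c d e v → IsClean G a b c d v := by
      intro v hv
      by_contra hv'
      exact hv.2.2.2.2 (hX.eq_of_not_isClean hP ⟨hv.1, hv.2.1, hv.2.2.1, hv.2.2.2.1⟩ he hv'
        (fun h => hbad (isTame_of_isClean' hP h)))
    rcases isExtension_of_not_isTame hbad with h | h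
    · exact hG.false_of_isExtension hE hP he.2.1 he.2.2.1 hclean h
    · refine hG.false_of_isExtension hE hP.reverse he.2.2.1 he.2.1 ?_ h
      exact fun v hv => (hclean v ⟨hv.2.2.2.1, hv.2.2.1, hv.2.1, hv.1, hv.2.2.2.2⟩).reverse
  · push Not at hbad
    have hM : ∀ v, IsOutside a b c d a v → IsInner G a b c d v := by
      intro v hv
      -- With no exceptional vertex, `a` takes the role of `e`. A path through two outside vertices
      -- that meets `a b c d` would make both unclean, hence equal.
      refine hG.adj_inner hE hP (e := a) ?_ ?_ ?_ ?_ ?_ v hv.1 hv.2.1 hv.2.2.1 hv.2.2.2.1 hv.1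
      · exact fun v a1 a2 a3 a4 _ => hbad v ⟨a1, a2, a3, a4⟩
      · exact fun v _ _ _ _ _ h _ _ _ => h
      · exact fun v _ _ _ _ _ h _ _ _ => h
      · intro v w a1 a2 a3 a4 _ b1 b2 b3 b4 _ h
        have hvw : v = w := hX.eq_of_not_isClean hP ⟨a1, a2, a3, a4⟩ ⟨b1, b2, b3, b4⟩
          (fun hc => (hc _ _ _ (.inl h) b (by simp)).2.1 rfl)
          (fun hc => (hc _ _ _ (.inr h.reverse) b (by simp)).2.1 rfl)
        exact h.ad (hvw ▸ h.cd)
      · intro v w a1 a2 a3 a4 _ b1 b2 b3 b4 _ h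
        refine h.ab.ne (hX.eq_of_not_isClean hP ⟨a1, a2, a3, a4⟩ ⟨b1, b2, b3, b4⟩
          (fun hc => (hc _ _ _ (.inl h) b (by simp)).2.1 rfl)
          (fun hc => (hc _ _ _ (.inr h) b (by simp)).2.1 rfl))
    exact hG.false_of_outer hP hM G.irrefl hP.ad (fun v hv => (hM v hv).1)
      (fun e => G.irrefl (e ▸ hP.ab)) (fun e => hP.ad (e ▸ hP.cd))

theorem Obstruction.isEssential [Finite V] (hG : Obstruction G) (hX : IsP4Extendible G) :
    IsEssential G := by
  classical
  by_contra hness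
  have hE := EssentialFree.of_obstruction hG hness
  have := Fintype.ofFinite V
  by_cases hV : (Finset.univ : Finset V).Nontrivial
  · obtain ⟨X, h⟩ := exists_separates (hG.not_isP4 hE hX) Finset.univ hV
    rw [Finset.coe_univ] at h
    exact h.elim (hG.not_separates hE X) (hG.not_separates_compl X)
  · have : ∀ x y : V, x = y := fun x y => by
      by_contra hxy
      exact hV ⟨x, by simp, y, by simp, hxy⟩
    exact hG.not_split Set.univ (fun x _ y _ h => absurd (this x y) h)
      (fun x hx => absurd trivial hx)

end PolarGraph

theorem mainTheorem9 {V : Type*} [Finite V] (G : SimpleGraph V)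
    (hG : PolarGraph.IsP4Extendible G) :
    PolarGraph.IsMinimalPolarObstruction ⊤ 1 G ↔ PolarGraph.IsEssential G := by
  rw [PolarGraph.isMinimalPolarObstruction_iff]
  exact ⟨fun h => h.isEssential hG, fun h => h.obstruction⟩
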